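/- Let $\Lambda=\bigoplus_{n\ge 0}\Lambda^n$ be the algebra of symmetric functions over $\mathbb{C}$ in variables $x=(x_1,x_2,\dots)$, with monomial symmetric functions $m_\lambda$ and power sums $p_n=\sum_i x_i^n$, $p_\lambda=\prod_i p_{\lambda_i}$, indexed by partitions $\lambda$. Let $z_\lambda=\prod_{j\ge1} j^{m_j}\,m_j!$, where $m_j$ is the multiplicity of $j$ in $\lambda$. For $q,t\in\mathbb{C}$, $|q|<1$, the Macdonald inner product is the bilinear form $$\langle p_\lambda,p_\mu\rangle_{q,t}=\delta_{\lambda,\mu}\,z_\lambda\prod_i\frac{1-q^{\lambda_i}}{1-t^{\lambda_i}},$$ and the monic Macdonald functions $M_\lambda(x;q,t)$ are characterised by $M_\lambda=m_\lambda+\sum_{\mu<\lambda}v_{\lambda,\mu}\,m_\mu$ with $v_{\lambda,\mu}\in\mathbb{C}$ (where $<$ is the strict dominance order on partitions of $|\lambda|$) and $\langle M_\lambda,M_\mu\rangle_{q,t}=0$ for $\lambda\ne\mu$. Let $k\ge 1$ be an integer, $\omega=e^{2\pi \mathrm{i}/k}$, and let $\beta\in\mathbb{C}$, $\beta\neq 0$.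 Let $$U_\lambda(x;\beta,k)=\lim_{p\to1}M_\lambda(x;\omega p,\omega p^\beta)$$ be the rank $k$ Uglov functions; here $p$ is real and tends to $1$ from below (so that $|q|=|\omega p|<1$), the limit is taken coefficientwise, and $\beta$ is such that, for every $\lambda$, the functions $M_\lambda(x;\omega p,\omega p^\beta)$ exist for $p$ close enough to $1$ and the limit exists. Let $\langle-,-\rangle_{\beta,k}$ be the limiting bilinear form $$\langle p_\lambda,p_\mu\rangle_{\beta,k}=\delta_{\lambda,\mu}\,z_\lambda\,\beta^{-\#\{i\,:\,\lambda_i\equiv0\ \mathrm{mod}\ k\}}.$$ Then $\langle U_\lambda,U_\lambda\rangle_{\beta,k}\ne0$ for every partition $\lambda$, and the following identities of formal power series in two sets of variables $x=(x_1,x_2,\dots)$ and $y=(y_1,y_2,\dots)$ hold, all infinite sums and products being convergent coefficientwise: $$\sum_\lambda\frac{U_\lambda(x;\beta,k)\,U_\lambda(y;\beta,k)}{\langle U_\lambda,U_\lambda\rangle_{\beta,k}} =\prod_{i,j\ge1}\Big((1-x_iy_j)^{-\frac{\beta-1+k}{k}}\prod_{a=1}^{k-1}(1-\omega^a x_iy_j)^{-\frac{\beta-1}{k}}\Big)$$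 $$=\exp\Big(\sum_{a=1}^{k-1}\ \sum_{\substack{n\ge1\\ n\equiv a\ \mathrm{mod}\ k}}\frac1n\,p_n(x)\,p_n(y)+\frac\beta k\sum_{n=1}^\infty\frac1n\,p_{nk}(x)\,p_{nk}(y)\Big),$$ where the sum on the left runs over all partitions and complex powers $(1-z)^r$ are given by the binomial series. -/

import Mathlib

open Filter Topology
open scoped MvPowerSeries.WithPiTopology

namespace Uglov

noncomputable section

/-! Symmetric functions in infinitely many variables `x_0, x_1, …` are realised as formal power
series, i.e. as elements of `MvPowerSeries ℕ ℂ`; those of degree `n` are the linear combinations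
of the `monomialFn l` for `l` a partition of `n`.  Spaces of power series carry the topology of
coefficientwise convergence. -/

/-- The monomial symmetric function `m_l`: the sum of all distinct monomials whose nonzero
exponents, counted with multiplicity, are the parts of `l`. -/
def monomialFn {n : ℕ} (l : n.Partition) : MvPowerSeries ℕ ℂ :=
  fun d => if d.support.val.map d = l.parts then 1 else 0

/-- The power sum `p_n = ∑ i, x_i ^ n`, for `n ≥ 1`. -/
def powerSum (n : ℕ) : MvPowerSeries ℕ ℂ :=
  open Classical in fun d => if ∃ i, d = Finsupp.single i n then 1 else 0

/-- The product `p_l` of the power sums of the parts of `l`. -/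
def powerSumFn {n : ℕ} (l : n.Partition) : MvPowerSeries ℕ ℂ :=
  (l.parts.map powerSum).prod

/-- Strict dominance order: `m ≠ l`, and for every `i` the sum of the `i` largest parts of `m` is
at most the sum of the `i` largest parts of `l`. -/
def DominatedBy {n : ℕ} (m l : n.Partition) : Prop :=
  m ≠ l ∧ ∀ i : ℕ,
    ((m.parts.sort (· ≥ ·)).take i).sum ≤ ((l.parts.sort (· ≥ ·)).take i).sum

/-- `z_l = ∏_j j ^ (m_j) * (m_j)!`, where `m_j` is the multiplicity of the part `j` in `l`. -/
def zCoeff {n : ℕ} (l : n.Partition) : ℕ :=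
  ∏ j ∈ l.parts.toFinset, j ^ l.parts.count j * (l.parts.count j).factorial

/-- The coordinates of a symmetric function of degree `n` in the basis `p_l`. -/
def powerSumCoeff (n : ℕ) (f : MvPowerSeries ℕ ℂ) : n.Partition → ℂ :=
  Function.invFun (fun c : n.Partition → ℂ => ∑ l, c l • powerSumFn l) f

/-- The bilinear form on symmetric functions of degree `n` with `⟨p_l, p_m⟩ = δ_{l,m} w_l`. -/
def diagonalForm {n : ℕ} (w : n.Partition → ℂ) (f g : MvPowerSeries ℕ ℂ) : ℂ :=
  ∑ l, w l * powerSumCoeff n f l * powerSumCoeff n g l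

/-- The Macdonald inner product in degree `n`:
`⟨p_l, p_m⟩_{q,t} = δ_{l,m} z_l ∏_i (1 - q ^ l_i) / (1 - t ^ l_i)`. -/
def macdonaldForm (q t : ℂ) (n : ℕ) : MvPowerSeries ℕ ℂ → MvPowerSeries ℕ ℂ → ℂ :=
  diagonalForm fun l : n.Partition =>
    (zCoeff l : ℂ) * (l.parts.map fun i => (1 - q ^ i) / (1 - t ^ i)).prod

/-- `P` is the family of monic Macdonald functions `M_l(x; q, t)` for the partitions `l` of `n`:
unitriangular in the monomial basis for the dominance order, and pairwise orthogonal. -/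
structure IsMacdonald (q t : ℂ) (n : ℕ) (P : n.Partition → MvPowerSeries ℕ ℂ) : Prop where
  triangular : ∀ l, ∃ v : n.Partition → ℂ, (∀ m, v m ≠ 0 → DominatedBy m l) ∧
    P l = monomialFn l + ∑ m, v m • monomialFn m
  orthogonal : ∀ l m, l ≠ m → macdonaldForm q t n (P l) (P m) = 0

/-- The primitive `k`-th root of unity `exp (2 π i / k)`. -/
def rootOfUnity (k : ℕ) : ℂ := Complex.exp (2 * Real.pi * Complex.I / k)

/-- `U` is the family of rank `k` Uglov functions
`U_l(x; β, k) = lim_{p → 1} M_l(x; ω p, ω p ^ β)`. As `|q| < 1`, the limit is taken over real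
`p < 1`; it is coefficientwise.  For given `n`, the Macdonald functions in degree `n` are only
needed for `p` close enough to `1`. -/
def IsUglov (β : ℂ) (k : ℕ) (U : ∀ n : ℕ, n.Partition → MvPowerSeries ℕ ℂ) : Prop :=
  ∀ n : ℕ, ∃ M : ℝ → n.Partition → MvPowerSeries ℕ ℂ,
    (∀ᶠ p : ℝ in 𝓝[<] 1,
      IsMacdonald (rootOfUnity k * p) (rootOfUnity k * (p : ℂ) ^ β) n (M p)) ∧
    ∀ l : n.Partition, Tendsto (fun p => M p l) (𝓝[<] 1) (𝓝 (U n l))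

/-- The limit of the Macdonald inner product, in degree `n`:
`⟨p_l, p_m⟩_{β,k} = δ_{l,m} z_l β ^ (-#{i : l_i ≡ 0 mod k})`. -/
def uglovForm (β : ℂ) (k n : ℕ) : MvPowerSeries ℕ ℂ → MvPowerSeries ℕ ℂ → ℂ :=
  diagonalForm fun l : n.Partition =>
    (zCoeff l : ℂ) * (β ^ (l.parts.countP fun i => k ∣ i))⁻¹

/-- The series `f(x)`, as a power series in the variables `x_i` (left) and `y_j` (right). -/
def inX (f : MvPowerSeries ℕ ℂ) : MvPowerSeries (ℕ ⊕ ℕ) ℂ :=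
  f.subst fun i => (MvPowerSeries.X (Sum.inl i) : MvPowerSeries (ℕ ⊕ ℕ) ℂ)

/-- The series `f(y)`, as a power series in the variables `x_i` (left) and `y_j` (right). -/
def inY (f : MvPowerSeries ℕ ℂ) : MvPowerSeries (ℕ ⊕ ℕ) ℂ :=
  f.subst fun j => (MvPowerSeries.X (Sum.inr j) : MvPowerSeries (ℕ ⊕ ℕ) ℂ)

/-- The product `x_i * y_j`. -/
def xy (i j : ℕ) : MvPowerSeries (ℕ ⊕ ℕ) ℂ :=
  MvPowerSeries.X (Sum.inl i) * MvPowerSeries.X (Sum.inr j)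

/-- The complex power `(1 - z) ^ r`, by the binomial series, of a power series `z` without
constant term. -/
def oneSubPow (z : MvPowerSeries (ℕ ⊕ ℕ) ℂ) (r : ℂ) : MvPowerSeries (ℕ ⊕ ℕ) ℂ :=
  (PowerSeries.binomialSeries ℂ r).subst (-z)

/-- The exponential series of a power series `z` without constant term. -/
def expSeries (z : MvPowerSeries (ℕ ⊕ ℕ) ℂ) : MvPowerSeries (ℕ ⊕ ℕ) ℂ :=
  (PowerSeries.exp ℂ).subst z

/-- The summand `U_l(x) U_l(y) / ⟨U_l, U_l⟩_{β,k}`. -/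
def cauchyTerm (β : ℂ) (k : ℕ) (U : ∀ n : ℕ, n.Partition → MvPowerSeries ℕ ℂ)
    (l : Σ n : ℕ, n.Partition) : MvPowerSeries (ℕ ⊕ ℕ) ℂ :=
  (1 / uglovForm β k l.1 (U l.1 l.2) (U l.1 l.2)) • (inX (U l.1 l.2) * inY (U l.1 l.2))

/-- The factor `(1 - x_i y_j)^(-(β-1+k)/k) ∏_{a=1}^{k-1} (1 - ω^a x_i y_j)^(-(β-1)/k)`. -/
def cauchyFactor (β : ℂ) (k : ℕ) (ij : ℕ × ℕ) : MvPowerSeries (ℕ ⊕ ℕ) ℂ :=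
  oneSubPow (xy ij.1 ij.2) (-((β - 1 + k) / k)) *
    ∏ a ∈ Finset.Icc 1 (k - 1),
      oneSubPow (rootOfUnity k ^ a • xy ij.1 ij.2) (-((β - 1) / k))

/-- The term `p_m(x) p_m(y) / n`. -/
def exponentTerm (n m : ℕ) : MvPowerSeries (ℕ ⊕ ℕ) ℂ :=
  (1 / (n : ℂ)) • (inX (powerSum m) * inY (powerSum m))

end

end Uglov

namespace Uglov

noncomputable section

/-! ### Exponentials of power series -/

open MvPowerSeries (constantCoeff coeff)
open Nat (factorial)

/-! Both sides are compared with the same series, the sum over all partitions `l` of `p_l(x) p_l(y)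
/ w_l`, where `w_l` is the weight of `p_l` in the limiting form.

For the product, take logarithms. Expanding `log (1 - z)` and using that the sum of `ω^(an)` over `0
≤ a < k` is `k` or `0`, the logarithm becomes the sum of `c_n p_n(x) p_n(y)` with `c_n = β/n` if `k
∣ n` and `1/n` otherwise (`hasSum_cauchyLog`, `exists_hasSum_powerSumProd`). Sorting by residues mod
`k` gives the stated exponent (`hasSum_exponent`), and the exponential formula over multisets gives
the expansion in power sums (`hasSum_multisetTerm`, `hasSum_partition`).

For the sum over Uglov functions, unitriangularity and orthogonality are closed conditions and the
Macdonald form converges to the limiting one, so in each degree the `U_l` are an orthogonal basis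
(`IsUglov.exists_matrix`). With `u` their matrix in the power sums and `D` the invertible diagonal
matrix of weights, `u D uᵀ` is diagonal and invertible, so the norms are nonzero. Inverting this
relation gives the dual relations (`dual_orthogonality`), which turn the sum over the `U_l` into the
sum over the `p_l` (`sum_cauchyTerm`).

All convergence is coefficientwise and rests on order bounds: each coefficient receives finitely
many nonzero contributions. -/

lemma hasSubst_of_constantCoeff {z : MvPowerSeries (ℕ ⊕ ℕ) ℂ} (hz : constantCoeff z = 0) :
    PowerSeries.HasSubst z :=
  PowerSeries.HasSubst.of_constantCoeff_zero hz

lemma coeff_eq_zero_of_le_order {σ : Type*} {f : MvPowerSeries σ ℂ} {n : ℕ} (hf : n ≤ f.order)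
    {d : σ →₀ ℕ} (hd : d.degree < n) : coeff d f = 0 :=
  MvPowerSeries.coeff_of_lt_order (lt_of_lt_of_le (by exact_mod_cast hd) hf)

lemma coeff_pow_eq_zero {σ : Type*} {z : MvPowerSeries σ ℂ} (hz : constantCoeff z = 0) {n : ℕ}
    {d : σ →₀ ℕ} (hd : d.degree < n) : coeff d (z ^ n) = 0 :=
  coeff_eq_zero_of_le_order (MvPowerSeries.le_order_pow_of_constantCoeff_eq_zero n hz) hd

/-- Coefficients of a substitution in one variable are finite sums. -/
lemma coeff_subst_eq_sum {z : MvPowerSeries (ℕ ⊕ ℕ) ℂ} (hz : constantCoeff z = 0)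
    (f : PowerSeries ℂ) (d : ℕ ⊕ ℕ →₀ ℕ) {N : ℕ} (hN : d.degree < N) :
    coeff d (f.subst z) = ∑ n ∈ Finset.range N, PowerSeries.coeff n f * coeff d (z ^ n) := by
  rw [PowerSeries.coeff_subst (hasSubst_of_constantCoeff hz)]
  rw [finsum_eq_sum_of_support_subset (s := Finset.range N)]
  · rfl
  · intro n hn
    by_contra h
    simp only [Finset.coe_range, Set.mem_Iio, not_lt] at h
    exact hn (by simp [coeff_pow_eq_zero hz (hN.trans_le h)])

/-- Bridges algebraic substitution and topology, so that theorems on infinite sums apply to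
`expSeries` and to logarithms. -/
lemma hasSum_subst {z : MvPowerSeries (ℕ ⊕ ℕ) ℂ} (hz : constantCoeff z = 0) (f : PowerSeries ℂ) :
    HasSum (fun n => PowerSeries.coeff n f • z ^ n) (f.subst z) := by
  rw [MvPowerSeries.WithPiTopology.hasSum_iff_hasSum_coeff]
  intro d
  rw [coeff_subst_eq_sum hz f d (Nat.lt_succ_self _)]
  refine hasSum_sum_of_ne_finset_zero fun n hn => ?_
  simp only [Finset.mem_range, not_lt] at hn
  simp [coeff_pow_eq_zero hz hn]

lemma coeff_expSeries {z : MvPowerSeries (ℕ ⊕ ℕ) ℂ} (hz : constantCoeff z = 0)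
    (d : ℕ ⊕ ℕ →₀ ℕ) {N : ℕ} (hN : d.degree < N) :
    coeff d (expSeries z) = ∑ n ∈ Finset.range N, (factorial n : ℂ)⁻¹ * coeff d (z ^ n) := by
  rw [expSeries, coeff_subst_eq_sum hz _ d hN]
  simp [PowerSeries.coeff_exp]

lemma hasSum_expSeries {z : MvPowerSeries (ℕ ⊕ ℕ) ℂ} (hz : constantCoeff z = 0) :
    HasSum (fun n => (factorial n : ℂ)⁻¹ • z ^ n) (expSeries z) := by
  have := hasSum_subst hz (PowerSeries.exp ℂ)
  simpa [PowerSeries.coeff_exp, expSeries] using this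

lemma expSeries_zero : expSeries 0 = 1 := by
  have h := hasSum_expSeries (z := 0) (by simp)
  refine h.unique ?_
  convert hasSum_single 0 _ using 1
  · simp
  · intro n hn
    simp [hn]

/-- Cauchy product and binomial theorem. The double family is summable because `z^i w^j` has order
at least `i + j`. -/
lemma expSeries_add {z w : MvPowerSeries (ℕ ⊕ ℕ) ℂ} (hz : constantCoeff z = 0)
    (hw : constantCoeff w = 0) : expSeries (z + w) = expSeries z * expSeries w := by
  have hs : Summable fun x : ℕ × ℕ =>
      ((factorial x.1 : ℂ)⁻¹ • z ^ x.1) * ((factorial x.2 : ℂ)⁻¹ • w ^ x.2) := by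
    rw [MvPowerSeries.WithPiTopology.summable_iff_summable_coeff]
    intro d
    refine summable_of_ne_finset_zero
      (s := Finset.range (d.degree + 1) ×ˢ Finset.range (d.degree + 1)) fun x hx => ?_
    have hlt : d.degree < x.1 + x.2 := by
      simp only [Finset.mem_product, Finset.mem_range] at hx
      omega
    rw [smul_mul_smul_comm, MvPowerSeries.coeff_smul]
    rw [coeff_eq_zero_of_le_order (n := x.1 + x.2) _ hlt, mul_zero]
    refine le_trans ?_ MvPowerSeries.le_order_mul
    push_cast
    exact add_le_add (MvPowerSeries.le_order_pow_of_constantCoeff_eq_zero _ hz)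
      (MvPowerSeries.le_order_pow_of_constantCoeff_eq_zero _ hw)
  have h1 := hasSum_expSeries hz
  have h2 := hasSum_expSeries hw
  have h3 := hasSum_expSeries (z := z + w) (by simp [hz, hw])
  rw [← h1.tsum_eq, ← h2.tsum_eq, ← h3.tsum_eq,
    h1.summable.tsum_mul_tsum_eq_tsum_sum_antidiagonal h2.summable hs]
  congr 1
  ext1 n
  rw [Commute.add_pow' (Commute.all z w), Finset.smul_sum]
  refine Finset.sum_congr rfl fun x hx => ?_
  replace hx : x.1 + x.2 = n := Finset.HasAntidiagonal.mem_antidiagonal.mp hx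
  rw [smul_mul_smul_comm, ← Nat.cast_smul_eq_nsmul ℂ, smul_smul, ← hx]
  congr 1
  have h := Nat.add_choose_mul_factorial_mul_factorial x.1 x.2
  rw [← Nat.choose_symm_add] at h
  have h1 := Nat.factorial_ne_zero x.1
  have h2 := Nat.factorial_ne_zero x.2
  have h3 := Nat.factorial_ne_zero (x.1 + x.2)
  field_simp
  exact_mod_cast h

lemma expSeries_sum {ι : Type*} (s : Finset ι) (f : ι → MvPowerSeries (ℕ ⊕ ℕ) ℂ)
    (hf : ∀ i, constantCoeff (f i) = 0) :
    expSeries (∑ i ∈ s, f i) = ∏ i ∈ s, expSeries (f i) := by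
  classical
  induction s using Finset.induction_on with
  | empty => simp [expSeries_zero]
  | insert i s hi ih =>
    rw [Finset.sum_insert hi, Finset.prod_insert hi, expSeries_add (hf i) (by simp [hf]), ih]

/-- With zero constant terms, the coefficient at `d` involves only the powers up to `d.degree`. This
truncation is uniform along the family, leaving a finite sum of continuous functions. -/
lemma tendsto_expSeries {ι : Type*} {l : Filter ι} {f : ι → MvPowerSeries (ℕ ⊕ ℕ) ℂ}
    {S : MvPowerSeries (ℕ ⊕ ℕ) ℂ} (hf : ∀ i, constantCoeff (f i) = 0) (hS : constantCoeff S = 0)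
    (h : Tendsto f l (𝓝 S)) : Tendsto (fun i => expSeries (f i)) l (𝓝 (expSeries S)) := by
  rw [MvPowerSeries.WithPiTopology.tendsto_iff_coeff_tendsto]
  intro d
  rw [coeff_expSeries hS d (Nat.lt_succ_self _)]
  simp_rw [fun i => coeff_expSeries (hf i) d (Nat.lt_succ_self _)]
  refine tendsto_finsetSum _ fun n _ => Tendsto.const_mul _ ?_
  exact ((MvPowerSeries.WithPiTopology.continuous_coeff ℂ d).tendsto _).comp (h.pow n)

lemma constantCoeff_eq_zero_of_hasSum {ι σ : Type*} {f : ι → MvPowerSeries σ ℂ}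
    {S : MvPowerSeries σ ℂ} (hf : ∀ i, constantCoeff (f i) = 0) (h : HasSum f S) :
    constantCoeff S = 0 := by
  have := MvPowerSeries.WithPiTopology.hasSum_iff_hasSum_coeff.mp h 0
  simp only [MvPowerSeries.coeff_zero_eq_constantCoeff, hf] at this
  exact this.unique hasSum_zero

lemma hasProd_expSeries {ι : Type*} {f : ι → MvPowerSeries (ℕ ⊕ ℕ) ℂ}
    {S : MvPowerSeries (ℕ ⊕ ℕ) ℂ} (hf : ∀ i, constantCoeff (f i) = 0) (h : HasSum f S) :
    HasProd (fun i => expSeries (f i)) (expSeries S) := by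
  have := tendsto_expSeries (fun s : Finset ι => by simp [hf])
    (constantCoeff_eq_zero_of_hasSum hf h) h
  simp only [expSeries_sum _ _ hf] at this
  exact this

/-- The term of the multiset `s` in the expansion of `exp (∑ j, Q j)`. -/
def multisetTerm (Q : ℕ → MvPowerSeries (ℕ ⊕ ℕ) ℂ) (s : Multiset ℕ) : MvPowerSeries (ℕ ⊕ ℕ) ℂ :=
  (∏ j ∈ s.toFinset, (factorial (s.count j) : ℂ))⁻¹ • (s.map Q).prod

lemma le_order_multiset_prod {σ : Type*} (s : Multiset ℕ) (Q : ℕ → MvPowerSeries σ ℂ)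
    (hQ : ∀ j : ℕ, (j : ℕ∞) ≤ (Q j).order) : (s.sum : ℕ∞) ≤ (s.map Q).prod.order := by
  induction s using Multiset.induction_on with
  | empty => simp
  | cons a s ih =>
    rw [Multiset.map_cons, Multiset.prod_cons, Multiset.sum_cons, Nat.cast_add]
    exact (add_le_add (hQ a) ih).trans MvPowerSeries.le_order_mul

lemma coeff_multisetTerm_eq_zero {Q : ℕ → MvPowerSeries (ℕ ⊕ ℕ) ℂ}
    (hQ : ∀ j : ℕ, (j : ℕ∞) ≤ (Q j).order) {s : Multiset ℕ} {d : ℕ ⊕ ℕ →₀ ℕ} (h : d.degree < s.sum) :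
    coeff d (multisetTerm Q s) = 0 := by
  rw [multisetTerm, MvPowerSeries.coeff_smul,
    coeff_eq_zero_of_le_order (le_order_multiset_prod s Q hQ) h, mul_zero]

lemma multisetTerm_eq_zero {Q : ℕ → MvPowerSeries (ℕ ⊕ ℕ) ℂ} (h0 : Q 0 = 0) {s : Multiset ℕ}
    (hs : 0 ∈ s) : multisetTerm Q s = 0 := by
  rw [multisetTerm, Multiset.prod_eq_zero (Multiset.mem_map.mpr ⟨0, hs, h0⟩), smul_zero]

/-- The multinomial theorem divided by `N!`: the multinomial coefficient is `N!` over the product of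
the factorials of the multiplicities. -/
lemma smul_sum_pow_eq (Q : ℕ → MvPowerSeries (ℕ ⊕ ℕ) ℂ) (J : Finset ℕ) (N : ℕ) :
    (factorial N : ℂ)⁻¹ • (∑ j ∈ J, Q j) ^ N =
      ∑ s ∈ J.sym N, multisetTerm Q (s : Multiset ℕ) := by
  rw [Finset.sum_pow, Finset.smul_sum]
  refine Finset.sum_congr rfl fun s _ => ?_
  rw [multisetTerm, Sym.val_eq_coe, ← nsmul_eq_mul, ← Nat.cast_smul_eq_nsmul ℂ, smul_smul]
  congr 1
  have hspec : (∏ j ∈ (s : Multiset ℕ).toFinset, factorial ((s : Multiset ℕ).count j)) *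
      (s : Multiset ℕ).countPerms = factorial N := by
    have h := Nat.multinomial_spec (s : Multiset ℕ).toFinset fun j => (s : Multiset ℕ).count j
    rw [Multiset.toFinset_sum_count_eq, Sym.card_coe] at h
    exact h
  have hN : (factorial N : ℂ) ≠ 0 := by exact_mod_cast Nat.factorial_ne_zero N
  rw [← hspec] at hN ⊢
  push_cast at hN ⊢
  rw [mul_inv, mul_assoc, inv_mul_cancel₀ (right_ne_zero_of_mul hN), mul_one]

lemma mem_of_sum_le {s : Multiset ℕ} (h0 : 0 ∉ s) {D : ℕ} (hs : s.sum ≤ D) :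
    s.card ≤ D ∧ ∀ j ∈ s, j ∈ Finset.Icc 1 D := by
  refine ⟨?_, fun j hj => ?_⟩
  · refine le_trans ?_ hs
    simpa using Multiset.card_nsmul_le_sum (s := s) (a := 1)
      fun j hj => Nat.one_le_iff_ne_zero.mpr fun h => h0 (h ▸ hj)
  · rw [Finset.mem_Icc]
    exact ⟨Nat.one_le_iff_ne_zero.mpr fun h => h0 (h ▸ hj),
      (Multiset.single_le_sum (fun _ _ => Nat.zero_le _) j hj).trans hs⟩

/-- `exp (∑ j, Q j)` is the sum over all multisets of the terms `∏ j, Q j ^ m_j / m_j!`. -/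
lemma hasSum_multisetTerm {Q : ℕ → MvPowerSeries (ℕ ⊕ ℕ) ℂ} {S : MvPowerSeries (ℕ ⊕ ℕ) ℂ}
    (h0 : Q 0 = 0) (hQ : ∀ j : ℕ, (j : ℕ∞) ≤ (Q j).order) (h : HasSum Q S) :
    HasSum (multisetTerm Q) (expSeries S) := by
  have hc : ∀ j, constantCoeff (Q j) = 0 := fun j => by
    rcases Nat.eq_zero_or_pos j with rfl | hj
    · simp [h0]
    · rw [← MvPowerSeries.one_le_order_iff_constCoeff_eq_zero]
      exact le_trans (by exact_mod_cast Nat.succ_le_of_lt hj) (hQ j)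
  rw [MvPowerSeries.WithPiTopology.hasSum_iff_hasSum_coeff]
  intro d
  -- A multiset of positive integers with sum at most `d.degree` has at most that many elements, all
  -- in `[1, d.degree]`. Multisets containing `0` or of larger sum contribute nothing.
  let T : Finset (Multiset ℕ) := (Finset.range (d.degree + 1)).biUnion fun N =>
    ((Finset.Icc 1 d.degree).sym N).image Sym.toMultiset
  have hT : ∀ s, s ∉ T → coeff d (multisetTerm Q s) = 0 := by
    intro s hs
    by_cases hs0 : 0 ∈ s
    · simp [multisetTerm_eq_zero h0 hs0]
    refine coeff_multisetTerm_eq_zero hQ (not_le.mp fun hle => hs ?_)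
    obtain ⟨hcard, hmem⟩ := mem_of_sum_le hs0 hle
    simp only [T, Finset.mem_biUnion, Finset.mem_range, Finset.mem_image]
    exact ⟨s.card, Nat.lt_succ_of_le hcard, Sym.mk s rfl, Finset.mem_sym_iff.mpr hmem, rfl⟩
  have hfin : ∀ J : Finset ℕ, Finset.Icc 1 d.degree ≤ J →
      coeff d (expSeries (∑ j ∈ J, Q j)) = ∑ s ∈ T, coeff d (multisetTerm Q s) := by
    intro J hJ
    rw [coeff_expSeries (by simp [hc]) d (Nat.lt_succ_self _), Finset.sum_biUnion]
    · refine Finset.sum_congr rfl fun N _ => ?_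
      rw [Finset.sum_image (fun _ _ _ _ h => Sym.coe_injective h),
        ← MvPowerSeries.coeff_smul, smul_sum_pow_eq, map_sum]
      refine (Finset.sum_subset (fun s hs => ?_) fun s _ hs => ?_).symm
      · rw [Finset.mem_sym_iff] at hs ⊢
        exact fun a ha => hJ (hs a ha)
      · by_cases hs0 : 0 ∈ (s : Multiset ℕ)
        · simp [multisetTerm_eq_zero h0 hs0]
        refine coeff_multisetTerm_eq_zero hQ (not_le.mp fun hle => hs ?_)
        exact Finset.mem_sym_iff.mpr (mem_of_sum_le hs0 hle).2
    · intro M _ N _ hMN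
      rw [Function.onFun, Finset.disjoint_left]
      intro s hs hs'
      simp only [Finset.mem_image] at hs hs'
      obtain ⟨a, -, rfl⟩ := hs
      obtain ⟨b, -, hb⟩ := hs'
      apply hMN
      rw [← Sym.card_coe (s := a), ← Sym.card_coe (s := b)]
      exact congrArg Multiset.card hb.symm
  -- By `hfin` the coefficient is constant once `J` contains `[1, d.degree]`, so its limit is that
  -- constant.
  have hlim := ((MvPowerSeries.WithPiTopology.continuous_coeff ℂ d).tendsto _).comp
    (tendsto_expSeries (fun J : Finset ℕ => by simp [hc])
      (constantCoeff_eq_zero_of_hasSum hc h) h)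
  have hconst := (tendsto_congr' ((eventually_ge_atTop (Finset.Icc 1 d.degree)).mono
    fun J hJ => hfin J hJ)).mp hlim
  rw [tendsto_nhds_unique hconst tendsto_const_nhds]
  exact hasSum_sum_of_ne_finset_zero hT

/-! ### Complex powers as exponentials -/

lemma choose_succ_mul (r : ℂ) (n : ℕ) :
    (n + 1) * Ring.choose r (n + 1) = (r - n) * Ring.choose r n := by
  rw [Ring.choose_eq_smul, Ring.choose_eq_smul, descPochhammer_succ_right,
    Polynomial.smeval_mul, Polynomial.smeval_sub, Polynomial.smeval_X, Polynomial.smeval_natCast,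
    Nat.factorial_succ]
  have : (factorial n : ℂ) ≠ 0 := by exact_mod_cast Nat.factorial_ne_zero n
  have : (n + 1 : ℂ) ≠ 0 := by exact_mod_cast Nat.succ_ne_zero n
  simp only [smul_eq_mul, pow_one, pow_zero, nsmul_eq_mul, mul_one]
  push_cast
  field_simp

/-- The recursion is the coefficient form of `(1 + X) F' = r F`. -/
lemma coeff_unique_of_recursion {F G : PowerSeries ℂ} {r : ℂ}
    (h0 : PowerSeries.coeff 0 F = PowerSeries.coeff 0 G)
    (hF : ∀ n : ℕ, (n + 1) * PowerSeries.coeff (n + 1) F = (r - n) * PowerSeries.coeff n F)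
    (hG : ∀ n : ℕ, (n + 1) * PowerSeries.coeff (n + 1) G = (r - n) * PowerSeries.coeff n G) :
    F = G := by
  ext n
  induction n with
  | zero => exact h0
  | succ n ih =>
    have : (n + 1 : ℂ) ≠ 0 := by exact_mod_cast Nat.succ_ne_zero n
    exact mul_left_cancel₀ this (by rw [hF, hG, ih])

lemma hasSubst_smul_log (r : ℂ) : PowerSeries.HasSubst (r • PowerSeries.log ℂ) :=
  PowerSeries.HasSubst.of_constantCoeff_zero' (by simp)

lemma one_add_X_mul_derivative_log :
    (1 + PowerSeries.X) * PowerSeries.derivative ℂ (PowerSeries.log ℂ) = 1 := by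
  ext n
  rw [PowerSeries.deriv_log, add_mul, one_mul]
  cases n with
  | zero => simp
  | succ n => simp [PowerSeries.coeff_succ_X_mul, PowerSeries.coeff_one, pow_succ]

/-- Both sides solve `(1 + X) F' = r F` with constant term `1`. -/
lemma binomialSeries_eq_exp_log (r : ℂ) :
    PowerSeries.binomialSeries ℂ r = (PowerSeries.exp ℂ).subst (r • PowerSeries.log ℂ) := by
  set E := (PowerSeries.exp ℂ).subst (r • PowerSeries.log ℂ) with hE
  have hd : (1 + PowerSeries.X) * PowerSeries.derivative ℂ E = r • E := by
    rw [hE, PowerSeries.derivative_subst (hasSubst_smul_log r), PowerSeries.derivative_exp,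
      Derivation.map_smul, mul_smul_comm, mul_smul_comm, mul_left_comm,
      one_add_X_mul_derivative_log, mul_one]
  refine coeff_unique_of_recursion (r := r) ?_ (fun n => ?_) fun n => ?_
  · rw [PowerSeries.coeff_zero_eq_constantCoeff_apply, PowerSeries.coeff_zero_eq_constantCoeff_apply,
      PowerSeries.binomialSeries_constantCoeff, hE]
    change 1 = MvPowerSeries.constantCoeff (PowerSeries.subst _ _)
    rw [PowerSeries.constantCoeff_subst (hasSubst_smul_log r), finsum_eq_single _ 0]
    · simp
    · intro n hn
      have : MvPowerSeries.constantCoeff ((r • PowerSeries.log ℂ) ^ n) = 0 := by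
        rw [map_pow]
        have : MvPowerSeries.constantCoeff (r • PowerSeries.log ℂ) = 0 :=
          (show PowerSeries.constantCoeff (r • PowerSeries.log ℂ) = 0 by simp)
        rw [this, zero_pow hn]
      rw [this, smul_zero]
  · simp only [PowerSeries.binomialSeries_coeff, smul_eq_mul, mul_one]
    exact choose_succ_mul r n
  · have := congrArg (PowerSeries.coeff n) hd
    rw [add_mul, one_mul, map_add, PowerSeries.coeff_derivative, PowerSeries.coeff_smul] at this
    cases n with
    | zero =>
      simp at this ⊢
      exact this
    | succ n =>
      rw [PowerSeries.coeff_succ_X_mul, PowerSeries.coeff_derivative] at this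
      push_cast at this ⊢
      simp only [smul_eq_mul] at this
      linear_combination this

lemma oneSubPow_eq_expSeries {z : MvPowerSeries (ℕ ⊕ ℕ) ℂ} (hz : constantCoeff z = 0) (r : ℂ) :
    oneSubPow z r = expSeries (r • (PowerSeries.log ℂ).subst (-z)) := by
  have h : PowerSeries.HasSubst (-z) := hasSubst_of_constantCoeff (by simp [hz])
  rw [oneSubPow, binomialSeries_eq_exp_log, PowerSeries.subst_comp_subst_apply
    (hasSubst_smul_log r) h, PowerSeries.subst_smul h, expSeries]

lemma hasSum_log_subst_neg {z : MvPowerSeries (ℕ ⊕ ℕ) ℂ} (hz : constantCoeff z = 0) :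
    HasSum (fun n : ℕ => (-(1 / (n : ℂ))) • z ^ n) ((PowerSeries.log ℂ).subst (-z)) := by
  convert hasSum_subst (z := -z) (by simp [hz]) (PowerSeries.log ℂ) using 2 with n
  rw [neg_pow, PowerSeries.coeff_log]
  rcases Nat.eq_zero_or_pos n with rfl | hn
  · simp
  have h1 : ((-1 : MvPowerSeries (ℕ ⊕ ℕ) ℂ)) ^ n = ((-1 : ℂ) ^ n) • 1 := by
    rcases Nat.even_or_odd n with h | h <;> simp [h.neg_one_pow]
  rw [if_neg hn.ne', h1, smul_mul_assoc, one_mul, smul_smul]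
  congr 1
  have h2 : (-1 : ℂ) ^ n * (-1) ^ n = 1 := by rw [← mul_pow]; simp
  simp only [map_div₀, map_pow, map_neg, map_one, map_natCast]
  rw [pow_succ]
  linear_combination (1 / (n : ℂ)) * h2

lemma constantCoeff_log_subst {z : MvPowerSeries (ℕ ⊕ ℕ) ℂ} (hz : constantCoeff z = 0) :
    constantCoeff ((PowerSeries.log ℂ).subst z) = 0 :=
  PowerSeries.constantCoeff_subst_eq_zero hz _ (by simp)

/-! ### Symmetric functions in two sets of variables -/

/-- `inX` as an algebra homomorphism. -/
def inXHom : MvPowerSeries ℕ ℂ →ₐ[ℂ] MvPowerSeries (ℕ ⊕ ℕ) ℂ :=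
  MvPowerSeries.rename (Function.Embedding.inl : ℕ ↪ ℕ ⊕ ℕ)

/-- `inY` as an algebra homomorphism. -/
def inYHom : MvPowerSeries ℕ ℂ →ₐ[ℂ] MvPowerSeries (ℕ ⊕ ℕ) ℂ :=
  MvPowerSeries.rename (Function.Embedding.inr : ℕ ↪ ℕ ⊕ ℕ)

lemma inX_eq (f : MvPowerSeries ℕ ℂ) : inX f = inXHom f :=
  (MvPowerSeries.rename_eq_subst (Function.Embedding.inl : ℕ ↪ ℕ ⊕ ℕ) f).symm

lemma inY_eq (f : MvPowerSeries ℕ ℂ) : inY f = inYHom f :=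
  (MvPowerSeries.rename_eq_subst (Function.Embedding.inr : ℕ ↪ ℕ ⊕ ℕ) f).symm

lemma continuous_rename (e : ℕ ↪ ℕ ⊕ ℕ) :
    Continuous (MvPowerSeries.rename (R := ℂ) e) := by
  refine continuous_pi fun d => ?_
  by_cases hd : ∃ x, Finsupp.embDomain e x = d
  · obtain ⟨x, rfl⟩ := hd
    exact (MvPowerSeries.WithPiTopology.continuous_coeff ℂ x).congr fun f =>
      (MvPowerSeries.coeff_embDomain_rename e f x).symm
  · refine (continuous_const (y := (0 : ℂ))).congr fun f => ?_
    refine (MvPowerSeries.coeff_rename_eq_zero _ f ?_).symm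
    rintro ⟨x, rfl⟩
    exact hd ⟨x, Finsupp.embDomain_eq_mapDomain e x⟩

lemma continuous_inXHom : Continuous inXHom := continuous_rename _

lemma continuous_inYHom : Continuous inYHom := continuous_rename _

lemma coeff_powerSum (n : ℕ) (d : ℕ →₀ ℕ) [Decidable (∃ i, d = Finsupp.single i n)] :
    coeff d (powerSum n) = if ∃ i, d = Finsupp.single i n then 1 else 0 := by
  rw [MvPowerSeries.coeff_apply, powerSum]
  congr

lemma hasSum_powerSum {n : ℕ} (hn : n ≠ 0) :
    HasSum (fun i => (MvPowerSeries.X i : MvPowerSeries ℕ ℂ) ^ n) (powerSum n) := by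
  classical
  rw [MvPowerSeries.WithPiTopology.hasSum_iff_hasSum_coeff]
  intro d
  simp only [MvPowerSeries.coeff_X_pow, coeff_powerSum]
  by_cases h : ∃ i, d = Finsupp.single i n
  · obtain ⟨i, rfl⟩ := h
    simp only [Finsupp.single_left_inj hn, exists_eq', if_true]
    simpa only [eq_comm] using hasSum_ite_eq i (1 : ℂ)
  · push Not at h
    simp [h, hasSum_zero]

/-- The product `p_n(x) p_n(y)`. -/
def powerSumProd (n : ℕ) : MvPowerSeries (ℕ ⊕ ℕ) ℂ := inX (powerSum n) * inY (powerSum n)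

lemma xy_pow (i j n : ℕ) : xy i j ^ n =
    MvPowerSeries.monomial (Finsupp.single (Sum.inl i) n + Finsupp.single (Sum.inr j) n) 1 := by
  rw [xy, mul_pow, MvPowerSeries.X_pow_eq, MvPowerSeries.X_pow_eq,
    MvPowerSeries.monomial_mul_monomial, one_mul]

lemma constantCoeff_xy (i j : ℕ) : constantCoeff (xy i j) = 0 := by simp [xy]

/-- A monomial `(x_i y_j)^n` with `n > 0` determines `i`, `j` and `n`. The condition `c 0 = 0` is
needed because every pair `(i, j)` would otherwise contribute to the constant term. -/
lemma summable_xy_pow {c : ℕ → ℂ} (h0 : c 0 = 0) :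
    Summable fun x : (ℕ × ℕ) × ℕ => c x.2 • xy x.1.1 x.1.2 ^ x.2 := by
  classical
  rw [MvPowerSeries.WithPiTopology.summable_iff_summable_coeff]
  intro d
  refine summable_of_ne_finset_zero (s := ((d.support.preimage Sum.inl Sum.inl_injective.injOn) ×ˢ
    (d.support.preimage Sum.inr Sum.inr_injective.injOn)) ×ˢ Finset.range (d.degree + 1)) ?_
  rintro ⟨⟨i, j⟩, n⟩ hx
  rw [xy_pow, MvPowerSeries.coeff_smul, MvPowerSeries.coeff_monomial]
  rcases Nat.eq_zero_or_pos n with rfl | hn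
  · simp [h0]
  rw [if_neg, mul_zero]
  rintro rfl
  apply hx
  simp [map_add, hn.ne']

lemma hasSum_xy_pow {n : ℕ} (hn : n ≠ 0) :
    HasSum (fun ij : ℕ × ℕ => xy ij.1 ij.2 ^ n) (powerSumProd n) := by
  have hX := (hasSum_powerSum hn).map inXHom continuous_inXHom
  have hY := (hasSum_powerSum hn).map inYHom continuous_inYHom
  have hs : Summable fun ij : ℕ × ℕ => xy ij.1 ij.2 ^ n := by
    have h := summable_xy_pow (c := fun m => if m = n then 1 else 0) (by simp [hn.symm])
    have hi : Function.Injective fun ij : ℕ × ℕ => (ij, n) := fun a b h => (Prod.mk.inj h).1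
    simpa [Function.comp_def] using h.comp_injective hi
  rw [powerSumProd, inX_eq, inY_eq]
  have he : ∀ ij : ℕ × ℕ, xy ij.1 ij.2 ^ n =
      (inXHom ∘ fun i => (MvPowerSeries.X i : MvPowerSeries ℕ ℂ) ^ n) ij.1 *
      (inYHom ∘ fun i => (MvPowerSeries.X i : MvPowerSeries ℕ ℂ) ^ n) ij.2 := fun ij => by
    simp [xy, inXHom, inYHom, mul_pow]
  simp_rw [he] at hs ⊢
  exact hX.mul hY hs

/-- Interchange of the summations over the exponent and over the pairs of variables. -/
lemma exists_hasSum_powerSumProd {c : ℕ → ℂ} (h0 : c 0 = 0)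
    {G : ℕ × ℕ → MvPowerSeries (ℕ ⊕ ℕ) ℂ}
    (hG : ∀ ij, HasSum (fun n => c n • xy ij.1 ij.2 ^ n) (G ij)) :
    ∃ S, HasSum G S ∧ HasSum (fun n => c n • powerSumProd n) S := by
  have hF := (summable_xy_pow h0).hasSum
  refine ⟨_, hF.prod_fiberwise hG, ?_⟩
  have hF' := (Equiv.prodComm ℕ (ℕ × ℕ)).hasSum_iff.mpr hF
  refine hF'.prod_fiberwise fun n => ?_
  rcases Nat.eq_zero_or_pos n with rfl | hn
  · simp [h0, hasSum_zero]
  · exact (hasSum_xy_pow hn.ne').const_smul (c n)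

lemma summable_smul_powerSumProd {c : ℕ → ℂ} (h0 : c 0 = 0) :
    Summable fun n => c n • powerSumProd n := by
  have h := summable_xy_pow h0
  obtain ⟨S, -, hS⟩ := exists_hasSum_powerSumProd h0 fun ij => (h.prod_factor ij).hasSum
  exact hS.summable

/-! ### The Cauchy product as an exponential -/

/-- The coefficient of `p_n(x) p_n(y)` in the logarithm of the Cauchy product. -/
def cauchyCoeff (β : ℂ) (k n : ℕ) : ℂ := if k ∣ n then β / n else 1 / n

lemma cauchyCoeff_zero (β : ℂ) (k : ℕ) : cauchyCoeff β k 0 = 0 := by simp [cauchyCoeff]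

lemma isPrimitiveRoot_rootOfUnity {k : ℕ} (hk : 0 < k) : IsPrimitiveRoot (rootOfUnity k) k :=
  Complex.isPrimitiveRoot_exp k hk.ne'

lemma sum_rootOfUnity_pow {k : ℕ} (hk : 0 < k) (n : ℕ) :
    1 + ∑ a ∈ Finset.Icc 1 (k - 1), (rootOfUnity k ^ a) ^ n = if k ∣ n then (k : ℂ) else 0 := by
  have hr : Finset.range k = insert 0 (Finset.Icc 1 (k - 1)) := by
    ext a
    simp only [Finset.mem_range, Finset.mem_insert, Finset.mem_Icc]
    omega
  have h : 1 + ∑ a ∈ Finset.Icc 1 (k - 1), (rootOfUnity k ^ a) ^ n =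
      ∑ a ∈ Finset.range k, (rootOfUnity k ^ n) ^ a := by
    rw [hr, Finset.sum_insert (by simp), pow_zero]
    simp_rw [← pow_mul, mul_comm]
  have hω := isPrimitiveRoot_rootOfUnity hk
  rw [h]
  split_ifs with hd
  · simp [(hω.pow_eq_one_iff_dvd n).mpr hd]
  · have h1 : rootOfUnity k ^ n ≠ 1 := fun h => hd ((hω.pow_eq_one_iff_dvd n).mp h)
    rw [geom_sum_eq h1, ← pow_mul, mul_comm, pow_mul, hω.pow_eq_one, one_pow, sub_self, zero_div]

/-- The logarithm of the factor of the Cauchy product at `(i, j)`. -/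
def cauchyLog (β : ℂ) (k : ℕ) (ij : ℕ × ℕ) : MvPowerSeries (ℕ ⊕ ℕ) ℂ :=
  (-((β - 1 + k) / k)) • (PowerSeries.log ℂ).subst (-xy ij.1 ij.2) +
    ∑ a ∈ Finset.Icc 1 (k - 1),
      (-((β - 1) / k)) • (PowerSeries.log ℂ).subst (-(rootOfUnity k ^ a • xy ij.1 ij.2))

lemma constantCoeff_smul_xy (c : ℂ) (i j : ℕ) : constantCoeff (c • xy i j) = 0 := by
  rw [MvPowerSeries.constantCoeff_smul, constantCoeff_xy, smul_zero]

lemma constantCoeff_cauchyLog (β : ℂ) (k : ℕ) (ij : ℕ × ℕ) :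
    constantCoeff (cauchyLog β k ij) = 0 := by
  rw [cauchyLog, map_add, map_sum, MvPowerSeries.constantCoeff_smul,
    constantCoeff_log_subst (by simp [constantCoeff_xy]), smul_zero, zero_add]
  refine Finset.sum_eq_zero fun a _ => ?_
  rw [MvPowerSeries.constantCoeff_smul,
    constantCoeff_log_subst (by rw [map_neg, constantCoeff_smul_xy, neg_zero]), smul_zero]

lemma cauchyFactor_eq_expSeries (β : ℂ) (k : ℕ) (ij : ℕ × ℕ) :
    cauchyFactor β k ij = expSeries (cauchyLog β k ij) := by
  have h1 : ∀ r : ℂ, constantCoeff (r • (PowerSeries.log ℂ).subst (-xy ij.1 ij.2)) = 0 :=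
    fun r => by
      rw [MvPowerSeries.constantCoeff_smul,
        constantCoeff_log_subst (by simp [constantCoeff_xy]), smul_zero]
  have h2 : ∀ (r : ℂ) (a : ℕ), constantCoeff
      (r • (PowerSeries.log ℂ).subst (-(rootOfUnity k ^ a • xy ij.1 ij.2))) = 0 :=
    fun r a => by
      rw [MvPowerSeries.constantCoeff_smul,
        constantCoeff_log_subst (by rw [map_neg, constantCoeff_smul_xy, neg_zero]), smul_zero]
  rw [cauchyFactor, cauchyLog, expSeries_add (h1 _) (by simp [h2]), expSeries_sum _ _ (h2 _),
    oneSubPow_eq_expSeries (constantCoeff_xy _ _)]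
  simp_rw [fun a => oneSubPow_eq_expSeries
    (constantCoeff_smul_xy (rootOfUnity k ^ a) ij.1 ij.2) (-((β - 1) / k))]

/-- As `(β-1+k)/k = 1 + (β-1)/k`, the coefficient of `z^n` is `1/n` times `1 + ((β-1)/k) ∑_{0 ≤ a <
k} ω^(an)`, which is `β/n` or `1/n`. -/
lemma hasSum_cauchyLog (β : ℂ) {k : ℕ} (hk : 0 < k) (ij : ℕ × ℕ) :
    HasSum (fun n => cauchyCoeff β k n • xy ij.1 ij.2 ^ n) (cauchyLog β k ij) := by
  have h1 := (hasSum_log_subst_neg (constantCoeff_xy ij.1 ij.2)).const_smul (-((β - 1 + k) / k))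
  have h2 := hasSum_sum (s := Finset.Icc 1 (k - 1)) fun a _ =>
    (hasSum_log_subst_neg (constantCoeff_smul_xy (rootOfUnity k ^ a) ij.1 ij.2)).const_smul
      (-((β - 1) / k))
  rw [cauchyLog]
  convert h1.add h2 using 1
  ext1 n
  simp_rw [smul_pow, smul_smul, ← Finset.sum_smul, ← add_smul, ← Finset.mul_sum]
  congr 1
  have h := sum_rootOfUnity_pow hk n
  have hk' : (k : ℂ) ≠ 0 := by exact_mod_cast hk.ne'
  rw [← eq_sub_iff_add_eq'] at h
  rw [h, cauchyCoeff]
  split_ifs <;> field_simp <;> ring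

lemma exponentTerm_eq (n m : ℕ) : exponentTerm n m = (1 / (n : ℂ)) • powerSumProd m := rfl

lemma summable_exponentTerm : Summable fun n : ℕ => exponentTerm n n :=
  summable_smul_powerSumProd (c := fun n => 1 / (n : ℂ)) (by simp)

lemma summable_exponentTerm_mul {k : ℕ} (hk : 0 < k) :
    Summable fun n : ℕ+ => exponentTerm n (n * k) := by
  have hk' : (k : ℂ) ≠ 0 := by exact_mod_cast hk.ne'
  have hi : Function.Injective fun n : ℕ+ => (n : ℕ) * k := fun a b h =>
    PNat.coe_injective (Nat.eq_of_mul_eq_mul_right hk h)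
  refine ((summable_exponentTerm.comp_injective hi).const_smul (k : ℂ)).congr fun n => ?_
  rw [Function.comp_apply, exponentTerm_eq, exponentTerm_eq, smul_smul]
  congr 1
  have : ((n : ℕ) : ℂ) ≠ 0 := by exact_mod_cast n.ne_zero
  push_cast
  field_simp

lemma hasSum_exponent (β : ℂ) {k : ℕ} (hk : 0 < k) :
    HasSum (fun n => cauchyCoeff β k n • powerSumProd n)
      ((∑ a ∈ Finset.Icc 1 (k - 1),
          ∑' n : {n : ℕ // 0 < n ∧ n ≡ a [MOD k]}, exponentTerm n n) +
        (β / k) • ∑' n : ℕ+, exponentTerm n (n * k)) := by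
  have hk' : (k : ℂ) ≠ 0 := by exact_mod_cast hk.ne'
  have h1 : ∀ a ∈ Finset.Icc 1 (k - 1), HasSum
      (Set.indicator {n : ℕ | 0 < n ∧ n ≡ a [MOD k]} fun n => exponentTerm n n)
      (∑' n : {n : ℕ // 0 < n ∧ n ≡ a [MOD k]}, exponentTerm n n) := fun a _ =>
    hasSum_subtype_iff_indicator.mp
      (summable_exponentTerm.subtype {n : ℕ | 0 < n ∧ n ≡ a [MOD k]}).hasSum
  -- Reindex the positive multiples of `k` as `nk`, using `β/(nk) = (β/k)(1/n)`. Indicators put all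
  -- residue classes on the common index set `ℕ`.
  have h2 : HasSum (Set.indicator {n : ℕ | 0 < n ∧ k ∣ n} fun n => β • exponentTerm n n)
      ((β / k) • ∑' n : ℕ+, exponentTerm n (n * k)) := by
    have hi : Function.Injective fun n : ℕ+ => (n : ℕ) * k := fun a b h =>
      PNat.coe_injective (Nat.eq_of_mul_eq_mul_right hk h)
    rw [← hi.hasSum_iff]
    · convert (summable_exponentTerm_mul hk).hasSum.const_smul (β / k) using 2 with n
      have : ((n : ℕ) : ℂ) ≠ 0 := by exact_mod_cast n.ne_zero
      rw [Function.comp_apply, Set.indicator_of_mem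
        (show (n : ℕ) * k ∈ {n : ℕ | 0 < n ∧ k ∣ n} from
          ⟨Nat.mul_pos n.pos hk, Dvd.intro_left _ rfl⟩), exponentTerm_eq, exponentTerm_eq,
        smul_smul, smul_smul]
      congr 1
      push_cast
      field_simp
    · intro n hn
      refine Set.indicator_of_notMem (fun hmem => hn ?_) _
      obtain ⟨h0, m, rfl⟩ := hmem
      exact ⟨⟨m, Nat.pos_of_mul_pos_left h0⟩, mul_comm _ _⟩
  convert (hasSum_sum h1).add h2 using 1
  ext1 n
  rcases Nat.eq_zero_or_pos n with rfl | hn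
  · simp [cauchyCoeff_zero]
  by_cases hd : k ∣ n
  · rw [Finset.sum_eq_zero, zero_add, Set.indicator_of_mem (show n ∈ {n | 0 < n ∧ k ∣ n} from
      ⟨hn, hd⟩), cauchyCoeff, if_pos hd, exponentTerm_eq, smul_smul, mul_one_div]
    intro a ha
    rw [Finset.mem_Icc] at ha
    refine Set.indicator_of_notMem (fun hmem => ?_) _
    have := Nat.le_of_dvd ha.1 ((hmem.2.dvd_iff dvd_rfl).mp hd)
    omega
  · rw [Finset.sum_eq_single (n % k), Set.indicator_of_notMem (s := {n | 0 < n ∧ k ∣ n})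
        (fun hmem => hd hmem.2), add_zero, Set.indicator_of_mem (show n ∈ {m | 0 < m ∧ m ≡ n % k [MOD k]} from
        ⟨hn, (Nat.mod_modEq n k).symm⟩), cauchyCoeff, if_neg hd, exponentTerm_eq]
    · intro a ha hne
      rw [Finset.mem_Icc] at ha
      refine Set.indicator_of_notMem (fun hmem => hne ?_) _
      rw [hmem.2, Nat.mod_eq_of_lt (by omega)]
    · intro h
      have h1 := Nat.mod_lt n hk
      have h2 : n % k ≠ 0 := fun h => hd (Nat.dvd_of_mod_eq_zero h)
      exact absurd (Finset.mem_Icc.mpr ⟨by omega, by omega⟩) h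

lemma hasProd_cauchyFactor (β : ℂ) {k : ℕ} (hk : 0 < k) :
    HasProd (cauchyFactor β k) (expSeries
      ((∑ a ∈ Finset.Icc 1 (k - 1),
          ∑' n : {n : ℕ // 0 < n ∧ n ≡ a [MOD k]}, exponentTerm n n) +
        (β / k) • ∑' n : ℕ+, exponentTerm n (n * k))) := by
  obtain ⟨S, hS, hS'⟩ := exists_hasSum_powerSumProd (cauchyCoeff_zero β k) (hasSum_cauchyLog β hk)
  rw [← hS'.unique (hasSum_exponent β hk)]
  simp_rw [funext (cauchyFactor_eq_expSeries β k)]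
  exact hasProd_expSeries (constantCoeff_cauchyLog β k) hS

/-! ### Expansion of the exponential in power sums -/

/-- The weight of a partition with parts `s` in the limiting bilinear form. -/
def uglovWeight (β : ℂ) (k : ℕ) {n : ℕ} (l : n.Partition) : ℂ :=
  (zCoeff l : ℂ) * (β ^ (l.parts.countP fun i => k ∣ i))⁻¹

lemma order_powerSumProd (n : ℕ) : (n : ℕ∞) ≤ (powerSumProd n).order := by
  rcases Nat.eq_zero_or_pos n with rfl | hn
  · simp
  refine MvPowerSeries.le_order fun d hd => ?_
  have h := MvPowerSeries.WithPiTopology.hasSum_iff_hasSum_coeff.mp (hasSum_xy_pow hn.ne') d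
  simp_rw [fun ij : ℕ × ℕ => coeff_pow_eq_zero (constantCoeff_xy ij.1 ij.2)
    (show d.degree < n by exact_mod_cast hd)] at h
  exact h.unique hasSum_zero

lemma multiset_prod_map_smul {A : Type*} [CommRing A] [Algebra ℂ A] (c : ℕ → ℂ) (P : ℕ → A)
    (s : Multiset ℕ) :
    (s.map fun n => c n • P n).prod = (s.map c).prod • (s.map P).prod := by
  induction s using Multiset.induction_on with
  | empty => simp
  | cons a s ih => rw [Multiset.map_cons, Multiset.prod_cons, ih, smul_mul_smul_comm]; simp

lemma prod_map_cauchyCoeff (β : ℂ) (k : ℕ) (s : Multiset ℕ) :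
    (s.map (cauchyCoeff β k)).prod =
      β ^ s.countP (fun i => k ∣ i) * (∏ j ∈ s.toFinset, (j : ℂ) ^ s.count j)⁻¹ := by
  rw [← Finset.prod_multiset_map_count]
  induction s using Multiset.induction_on with
  | empty => simp
  | cons a s ih =>
    rw [Multiset.map_cons, Multiset.prod_cons, ih, Multiset.map_cons, Multiset.prod_cons,
      Multiset.countP_cons, cauchyCoeff, mul_inv]
    split_ifs
    · rw [pow_succ]
      ring
    · rw [add_zero]
      ring

lemma multisetTerm_parts {β : ℂ} {k n : ℕ} (l : n.Partition) :
    multisetTerm (fun n => cauchyCoeff β k n • powerSumProd n) l.parts =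
      (uglovWeight β k l)⁻¹ • (inX (powerSumFn l) * inY (powerSumFn l)) := by
  rw [multisetTerm, multiset_prod_map_smul, smul_smul, prod_map_cauchyCoeff, inX_eq, inY_eq,
    powerSumFn, map_multiset_prod, map_multiset_prod, Multiset.map_map, Multiset.map_map,
    ← Multiset.prod_map_mul]
  congr 1
  · rw [uglovWeight, zCoeff, mul_inv, inv_inv]
    push_cast
    rw [Finset.prod_mul_distrib, mul_inv]
    ring
  · simp only [← inX_eq, ← inY_eq, Function.comp_apply]
    rfl

/-- Partitions are the multisets without `0`, and a multiset containing `0` has vanishing term since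
`c_0 = 0`. -/
lemma hasSum_partition {β S} {k : ℕ} (h : HasSum (fun n => cauchyCoeff β k n • powerSumProd n) S) :
    HasSum (fun l : Σ n : ℕ, n.Partition =>
      (uglovWeight β k l.2)⁻¹ • (inX (powerSumFn l.2) * inY (powerSumFn l.2))) (expSeries S) := by
  have h0 : cauchyCoeff β k 0 • powerSumProd 0 = 0 := by rw [cauchyCoeff_zero, zero_smul]
  have hsum := hasSum_multisetTerm h0 (fun j => (order_powerSumProd j).trans
    MvPowerSeries.le_order_smul) h
  have hi : Function.Injective fun l : Σ n : ℕ, n.Partition => l.2.parts := by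
    rintro ⟨n, l⟩ ⟨m, l'⟩ hl
    obtain rfl : n = m := by rw [← l.parts_sum, ← l'.parts_sum]; exact congrArg _ hl
    exact congrArg _ (Nat.Partition.ext hl)
  rw [← hi.hasSum_iff] at hsum
  · simpa only [Function.comp_def, multisetTerm_parts] using hsum
  · intro s hs
    refine multisetTerm_eq_zero h0 ?_
    by_contra hs0
    exact hs ⟨⟨s.sum, ⟨s, fun hi => Nat.pos_of_ne_zero fun h => hs0 (h ▸ hi), rfl⟩⟩, rfl⟩

/-! ### Power sums and monomial symmetric functions -/

/-- The multiset of nonzero exponents of a monomial. -/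
def exponents (d : ℕ →₀ ℕ) : Multiset ℕ := d.support.val.map d

lemma exponents_add_single {e : ℕ →₀ ℕ} {i : ℕ} (hi : e i = 0) (a : ℕ) :
    exponents (e + Finsupp.single i a) = (if a = 0 then 0 else {a}) + exponents e := by
  split_ifs with ha
  · simp [ha]
  have hi' : i ∉ e.support := by simpa using hi
  have hs : (e + Finsupp.single i a).support = Finset.cons i e.support hi' := by
    ext j
    rcases eq_or_ne i j with rfl | h
    · simp [ha]
    · simp [Finsupp.single_eq_of_ne' h, h.symm]
  rw [exponents, hs, Finset.cons_val, Multiset.map_cons, exponents, Multiset.singleton_add]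
  congr 1
  · simp [hi]
  · refine Multiset.map_congr rfl fun j hj => ?_
    have : i ≠ j := fun h => hi' (h ▸ hj)
    simp [Finsupp.single_eq_of_ne' this]

lemma exponents_zero : exponents 0 = 0 := rfl

lemma exponents_eq_zero_iff (d : ℕ →₀ ℕ) : exponents d = 0 ↔ d = 0 := by
  simp [exponents]

lemma sum_map_exponents (F : ℕ → ℕ) (d : ℕ →₀ ℕ) :
    ((exponents d).map F).sum = ∑ i ∈ d.support, F (d i) := by
  rw [exponents, Multiset.map_map]
  rfl

lemma zero_notMem_exponents (d : ℕ →₀ ℕ) : 0 ∉ exponents d := by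
  simp [exponents]

lemma exponents_sub_single {d : ℕ →₀ ℕ} {i n : ℕ} (hi : i ∈ d.support) :
    exponents (d - Finsupp.single i n) =
      (if d i - n = 0 then 0 else {d i - n}) + (exponents d).erase (d i) := by
  have h1 : d = d.erase i + Finsupp.single i (d i) := (Finsupp.erase_add_single i d).symm
  have h2 : d - Finsupp.single i n = d.erase i + Finsupp.single i (d i - n) := by
    ext j
    rcases eq_or_ne i j with rfl | h
    · simp
    · simp [Finsupp.single_eq_of_ne' h, Finsupp.erase_ne h.symm]
  have h3 : exponents d = {d i} + exponents (d.erase i) := by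
    conv_lhs => rw [h1]
    rw [exponents_add_single (by simp), if_neg (by simpa using hi)]
  rw [h2, exponents_add_single (by simp), h3, Multiset.singleton_add, Multiset.erase_cons_head]

lemma exists_exponents_eq {v : Multiset ℕ} (hv : ∀ a ∈ v, 0 < a) :
    ∃ d : ℕ →₀ ℕ, exponents d = v := by
  induction v using Multiset.induction_on with
  | empty => exact ⟨0, exponents_zero⟩
  | cons a v ih =>
    obtain ⟨e, he⟩ := ih fun b hb => hv b (Multiset.mem_cons_of_mem hb)
    obtain ⟨i, hi⟩ := Infinite.exists_notMem_finset e.support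
    refine ⟨e + Finsupp.single i a, ?_⟩
    rw [exponents_add_single (by simpa using hi),
      if_neg (hv a (Multiset.mem_cons_self a v)).ne', he, Multiset.singleton_add]

lemma coeff_powerSum_mul {n : ℕ} (hn : n ≠ 0) (f : MvPowerSeries ℕ ℂ) (d : ℕ →₀ ℕ) :
    coeff d (powerSum n * f) =
      ∑ i ∈ d.support, if n ≤ d i then coeff (d - Finsupp.single i n) f else 0 := by
  classical
  have h := MvPowerSeries.WithPiTopology.hasSum_iff_hasSum_coeff.mp
    ((hasSum_powerSum hn).mul_right f) d
  simp_rw [MvPowerSeries.X_pow_eq, MvPowerSeries.coeff_monomial_mul, one_mul,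
    Finsupp.single_le_iff] at h
  refine h.unique (hasSum_sum_of_ne_finset_zero fun i hi => if_neg ?_)
  rw [Finsupp.notMem_support_iff] at hi
  omega

/-- The coefficients of a product of power sums: they only depend on the multiset of exponents,
and are supported on coarsenings. -/
lemma exists_coeff_prod_powerSum {s : Multiset ℕ} (hs : ∀ i ∈ s, 0 < i) :
    ∃ g : Multiset ℕ → ℕ, (∀ d, coeff d (s.map powerSum).prod = g (exponents d)) ∧
      (∀ v, g v ≠ 0 → v.sum = s.sum ∧ v.card ≤ s.card ∧ (v.card = s.card → v = s)) ∧
      g s ≠ 0 := by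
  classical
  induction s using Multiset.induction_on with
  | empty =>
    refine ⟨fun v => if v = 0 then 1 else 0, fun d => ?_, fun v hv => ?_, by simp⟩
    · simp [MvPowerSeries.coeff_one, exponents_eq_zero_iff]
    · have : v = 0 := by
        by_contra h
        exact hv (if_neg h)
      simp [this]
  | cons n s ih =>
    obtain ⟨g, h1, h2, h3⟩ := ih fun i hi => hs i (Multiset.mem_cons_of_mem hi)
    have hn : n ≠ 0 := (hs n (Multiset.mem_cons_self n s)).ne'
    -- Multiplying by `p_n` adds `n` to one exponent, so the coefficient at `v` sums over the
    -- entries `a ≥ n` of `v`, each replaced by `a - n` and dropped if this is `0`. Values in `ℕ`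
    -- exclude cancellation, as `g s ≠ 0` requires.
    refine ⟨fun v => (v.map fun a => if n ≤ a then
      g ((if a - n = 0 then 0 else {a - n}) + v.erase a) else 0).sum, fun d => ?_, fun v hv => ?_,
      ?_⟩
    · rw [Multiset.map_cons, Multiset.prod_cons, coeff_powerSum_mul hn]
      beta_reduce
      rw [sum_map_exponents, Nat.cast_sum]
      refine Finset.sum_congr rfl fun i hi => ?_
      by_cases h : n ≤ d i
      · rw [if_pos h, if_pos h, h1, exponents_sub_single hi]
      · rw [if_neg h, if_neg h, Nat.cast_zero]
    · have hex : ∃ a ∈ v, n ≤ a ∧ g ((if a - n = 0 then 0 else {a - n}) + v.erase a) ≠ 0 := by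
        by_contra hcon
        push Not at hcon
        refine hv (Multiset.sum_eq_zero fun x hx => ?_)
        obtain ⟨a, ha, rfl⟩ := Multiset.mem_map.mp hx
        split_ifs with h h'
        · simpa [h'] using hcon a ha h
        · simpa [h'] using hcon a ha h
        · rfl
      obtain ⟨a, ha, hna, hg⟩ := hex
      obtain ⟨v, rfl⟩ := Multiset.exists_cons_of_mem ha
      obtain ⟨k1, k2, k3⟩ := h2 _ hg
      rw [Multiset.erase_cons_head] at k1 k2 k3
      split_ifs at k1 k2 k3 with h
      · obtain rfl : a = n := by omega
        simp only [zero_add] at k1 k2 k3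
        simp only [Multiset.sum_cons, Multiset.card_cons]
        refine ⟨by omega, by omega, fun h => ?_⟩
        rw [k3 (by omega)]
      · simp only [Multiset.sum_add, Multiset.sum_singleton, Multiset.card_add,
          Multiset.card_singleton] at k1 k2
        simp only [Multiset.sum_cons, Multiset.card_cons]
        -- Here `n` was added to an existing exponent, so `v` has strictly fewer entries than `n ::ₘ
        -- s` and the equality case is vacuous.
        exact ⟨by omega, by omega, by omega⟩
    · refine ne_of_gt (lt_of_lt_of_le (Nat.pos_of_ne_zero h3) ?_)
      refine Multiset.single_le_sum (fun _ _ => Nat.zero_le _) _ ?_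
      exact Multiset.mem_map.mpr ⟨n, Multiset.mem_cons_self n s, by simp⟩

variable {n : ℕ}

/-- A monomial of shape `l`. -/
def shape (l : n.Partition) : ℕ →₀ ℕ := (exists_exponents_eq fun _ => l.parts_pos).choose

lemma exponents_shape (l : n.Partition) : exponents (shape l) = l.parts :=
  (exists_exponents_eq fun _ => l.parts_pos).choose_spec

lemma coeff_shape_monomialFn (m l : n.Partition) :
    coeff (shape m) (monomialFn l) = if m = l then 1 else 0 := by
  change (if exponents (shape m) = l.parts then (1 : ℂ) else 0) = _
  rw [exponents_shape]
  simp [Nat.Partition.ext_iff]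

/-- The linear map `c ↦ ∑ l, c l • p_l`. -/
def powerSumMap (n : ℕ) : (n.Partition → ℂ) →ₗ[ℂ] MvPowerSeries ℕ ℂ :=
  Fintype.linearCombination ℂ powerSumFn

lemma powerSumMap_apply (c : n.Partition → ℂ) : powerSumMap n c = ∑ l, c l • powerSumFn l := rfl

/-- The coefficients at the monomials of the shapes of the partitions of `n`. -/
def shapeCoeff (n : ℕ) : MvPowerSeries ℕ ℂ →ₗ[ℂ] (n.Partition → ℂ) :=
  LinearMap.pi fun l => coeff (shape l)

lemma shapeCoeff_apply (f : MvPowerSeries ℕ ℂ) (l : n.Partition) :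
    shapeCoeff n f l = coeff (shape l) f := rfl

/-- Triangularity by number of parts: the monomials of `p_m` come from merging parts of `m`. For `l`
with the most parts among those with `c l ≠ 0`, only `p_l` reaches the monomial of shape `l`. -/
lemma shapeCoeff_comp_powerSumMap_injective :
    Function.Injective (shapeCoeff n ∘ₗ powerSumMap n) := by
  rw [injective_iff_map_eq_zero]
  intro c hc
  by_contra hne
  obtain ⟨l₀, hl₀⟩ := Function.ne_iff.mp hne
  obtain ⟨l, hl, hmax⟩ := Finset.exists_max_image
    (Finset.univ.filter fun l : n.Partition => c l ≠ 0) (fun l => l.parts.card) ⟨l₀, by simpa⟩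
  simp only [Finset.mem_filter, Finset.mem_univ, true_and] at hl hmax
  have h := congrFun hc l
  simp only [LinearMap.comp_apply, shapeCoeff_apply, powerSumMap_apply, map_sum,
    MvPowerSeries.coeff_smul, Pi.zero_apply] at h
  obtain ⟨g, h1, -, h3⟩ := exists_coeff_prod_powerSum fun i hi => l.parts_pos (i := i) hi
  rw [Finset.sum_eq_single l] at h
  · rw [powerSumFn, h1, exponents_shape] at h
    exact mul_ne_zero hl (by exact_mod_cast h3) h
  · intro m _ hml
    by_cases hm : c m = 0
    · rw [hm, zero_mul]
    obtain ⟨g, h1, h2, -⟩ := exists_coeff_prod_powerSum fun i hi => m.parts_pos (i := i) hi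
    rw [powerSumFn, h1, exponents_shape]
    have : g l.parts = 0 := by
      by_contra hg
      obtain ⟨-, k2, k3⟩ := h2 _ hg
      exact hml (Nat.Partition.ext (k3 (le_antisymm k2 (hmax m hm))).symm)
    rw [this, Nat.cast_zero, mul_zero]
  · simp

lemma powerSumMap_injective : Function.Injective (powerSumMap n) := fun _ _ h =>
  shapeCoeff_comp_powerSumMap_injective (congrArg (shapeCoeff n) h)

lemma powerSumFn_eq_sum_monomialFn (l : n.Partition) :
    powerSumFn l = ∑ m, shapeCoeff n (powerSumFn l) m • monomialFn m := by
  obtain ⟨g, h1, h2, -⟩ := exists_coeff_prod_powerSum fun i hi => l.parts_pos (i := i) hi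
  ext d
  simp only [map_sum, MvPowerSeries.coeff_smul, shapeCoeff_apply]
  have hm : ∀ m : n.Partition, coeff d (monomialFn m) = if exponents d = m.parts then 1 else 0 :=
    fun _ => rfl
  simp_rw [hm, powerSumFn, h1, exponents_shape]
  by_cases hd : ∃ m : n.Partition, exponents d = m.parts
  · obtain ⟨m, hm⟩ := hd
    rw [Finset.sum_eq_single m]
    · simp [hm]
    · intro m' _ hne
      rw [if_neg, mul_zero]
      rw [hm]
      exact fun h => hne (Nat.Partition.ext h.symm)
    · simp
  · push Not at hd
    rw [Finset.sum_eq_zero fun m _ => by rw [if_neg (hd m), mul_zero]]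
    by_contra hg
    have hsum := (h2 _ fun h => hg (by rw [h, Nat.cast_zero])).1
    rw [l.parts_sum] at hsum
    exact hd ⟨exponents d, fun hi => Nat.pos_of_ne_zero fun h =>
      zero_notMem_exponents d (h ▸ hi), hsum⟩ rfl

lemma powerSumMap_eq_sum_monomialFn (c : n.Partition → ℂ) :
    powerSumMap n c = ∑ m, shapeCoeff n (powerSumMap n c) m • monomialFn m := by
  conv_lhs => rw [powerSumMap_apply]
  simp_rw [powerSumMap_apply, map_sum, map_smul, Finset.sum_apply, Pi.smul_apply, Finset.sum_smul,
    smul_assoc]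
  rw [Finset.sum_comm]
  refine Finset.sum_congr rfl fun l _ => ?_
  rw [← Finset.smul_sum, ← powerSumFn_eq_sum_monomialFn]

/-- An injective endomorphism of a finite-dimensional space is surjective, so some combination of
power sums has the monomial coefficients of `m_l`. -/
lemma monomialFn_mem_range (l : n.Partition) :
    monomialFn l ∈ LinearMap.range (powerSumMap n) := by
  classical
  obtain ⟨c, hc⟩ := LinearMap.injective_iff_surjective.mp
    (shapeCoeff_comp_powerSumMap_injective (n := n)) (Pi.single l 1)
  refine ⟨c, ?_⟩
  rw [powerSumMap_eq_sum_monomialFn]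
  rw [LinearMap.comp_apply] at hc
  simp [hc, Pi.single_apply]

lemma powerSumCoeff_powerSumMap (c : n.Partition → ℂ) :
    powerSumCoeff n (powerSumMap n c) = c :=
  Function.leftInverse_invFun (f := fun c : n.Partition → ℂ => ∑ l, c l • powerSumFn l)
    powerSumMap_injective c

/-- Used twice for the limit `p → 1`: limits stay in the span of the power sums, and coordinates
converge. -/
lemma isClosedEmbedding_powerSumMap : IsClosedEmbedding (powerSumMap n) :=
  LinearMap.isClosedEmbedding_of_injective (LinearMap.ker_eq_bot.mpr powerSumMap_injective)

lemma diagonalForm_powerSumMap (w a b : n.Partition → ℂ) :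
    diagonalForm w (powerSumMap n a) (powerSumMap n b) = ∑ l, w l * a l * b l := by
  simp only [diagonalForm, powerSumCoeff_powerSumMap]

/-! ### Dominance order -/

lemma list_eq_of_sum_take_eq {L₁ L₂ : List ℕ} (h₁ : ∀ x ∈ L₁, 0 < x) (h₂ : ∀ x ∈ L₂, 0 < x)
    (h : ∀ i, (L₁.take i).sum = (L₂.take i).sum) : L₁ = L₂ := by
  induction L₁ generalizing L₂ with
  | nil =>
    cases L₂ with
    | nil => rfl
    | cons b L₂ =>
      have := h 1
      have := h₂ b (by simp)
      simp_all
  | cons a L₁ ih =>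
    cases L₂ with
    | nil =>
      have := h 1
      have := h₁ a (by simp)
      simp_all
    | cons b L₂ =>
      obtain rfl : a = b := by simpa using h 1
      rw [ih (fun x hx => h₁ x (List.mem_cons_of_mem _ hx))
        (fun x hx => h₂ x (List.mem_cons_of_mem _ hx)) fun i => by simpa using h (i + 1)]

/-- The partial sums of the parts of a partition, in decreasing order. -/
def partialSums (l : n.Partition) (i : ℕ) : ℕ := ((l.parts.sort (· ≥ ·)).take i).sum

lemma partialSums_injective : Function.Injective (partialSums (n := n)) := by
  intro l m h
  have := list_eq_of_sum_take_eq (L₁ := l.parts.sort (· ≥ ·)) (L₂ := m.parts.sort (· ≥ ·))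
    (fun x hx => l.parts_pos (by simpa using hx)) (fun x hx => m.parts_pos (by simpa using hx))
    (congrFun h)
  refine Nat.Partition.ext ?_
  rw [← Multiset.sort_eq l.parts (· ≥ ·), this, Multiset.sort_eq]

/-- Embeds dominance in the pointwise order on functions, where maximal elements of finite sets are
available. -/
lemma DominatedBy.lt {m l : n.Partition} (h : DominatedBy m l) : partialSums m < partialSums l :=
  lt_of_le_of_ne h.2 fun he => h.1 (partialSums_injective he)

/-- A family which is unitriangular for the dominance order is linearly independent. -/
lemma isUnit_of_unitriangular {T : Matrix n.Partition n.Partition ℂ} (h1 : ∀ l, T l l = 1)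
    (h2 : ∀ l m, l ≠ m → T l m ≠ 0 → DominatedBy m l) : IsUnit T := by
  rw [← Matrix.linearIndependent_rows_iff_isUnit, Fintype.linearIndependent_iff]
  intro c hc
  by_contra! hne
  obtain ⟨l₀, hl₀⟩ := hne
  obtain ⟨l, hl⟩ := (Finset.univ.filter fun l : n.Partition => c l ≠ 0).exists_maximalFor
    partialSums ⟨l₀, by simpa⟩
  obtain ⟨hl, hmax⟩ := hl
  simp only [Finset.mem_filter, Finset.mem_univ, true_and] at hl hmax
  have h := congrFun hc l
  rw [Finset.sum_apply, Finset.sum_eq_single l] at h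
  · simp [h1] at h
    exact hl h
  · intro m _ hml
    by_cases hm : c m = 0
    · simp [hm]
    by_cases hT : T m l = 0
    · simp [hT]
    have hlt := (h2 m l hml hT).lt
    exact absurd (hmax hm hlt.le) (not_le_of_gt hlt)
  · simp

/-! ### The limit of the Macdonald form -/

lemma tendsto_ofReal_nhdsWithin : Tendsto (fun p : ℝ => (p : ℂ)) (𝓝[<] 1) (𝓝 1) := by
  have h := (Complex.continuous_ofReal.tendsto 1).mono_left (nhdsWithin_le_nhds (s := Set.Iio 1))
  simpa using h

lemma hasDerivAt_cpow_one (β : ℂ) : HasDerivAt (fun z : ℂ => z ^ β) β 1 := by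
  simpa using (hasDerivAt_id (1 : ℂ)).cpow_const (c := β) (by simp)

lemma tendsto_cpow_nhdsWithin (β : ℂ) :
    Tendsto (fun p : ℝ => (p : ℂ) ^ β) (𝓝[<] 1) (𝓝 1) := by
  have h : ContinuousAt (fun z : ℂ => z ^ β) 1 :=
    (hasDerivAt_cpow_one β).continuousAt
  have := h.tendsto.comp tendsto_ofReal_nhdsWithin
  simpa [Function.comp_def] using this

/-- Numerator and denominator vanish at `1` with derivatives `-i` and `-iβ`; the quotient is a ratio
of slopes. -/
lemma tendsto_div_of_dvd {β : ℂ} (hβ : β ≠ 0) {i : ℕ} (hi : i ≠ 0) :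
    Tendsto (fun p : ℝ => (1 - (p : ℂ) ^ i) / (1 - ((p : ℂ) ^ β) ^ i)) (𝓝[<] 1) (𝓝 β⁻¹) := by
  have hd1 : HasDerivAt (fun z : ℂ => 1 - z ^ i) (-(i : ℂ)) 1 := by
    simpa using (hasDerivAt_pow i (1 : ℂ)).const_sub 1
  have hd2 : HasDerivAt (fun z : ℂ => 1 - (z ^ β) ^ i) (-(i * β)) 1 := by
    have := (((hasDerivAt_cpow_one β)).fun_pow
      i).const_sub 1
    simpa using this
  have hi' : (i : ℂ) ≠ 0 := by exact_mod_cast hi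
  have hs := (hasDerivAt_iff_tendsto_slope.mp hd1).div (hasDerivAt_iff_tendsto_slope.mp hd2)
    (neg_ne_zero.mpr (mul_ne_zero hi' hβ))
  have hlim : Tendsto (fun p : ℝ => (p : ℂ)) (𝓝[<] 1) (𝓝[≠] 1) := by
    refine tendsto_nhdsWithin_iff.mpr ⟨tendsto_ofReal_nhdsWithin, ?_⟩
    filter_upwards [self_mem_nhdsWithin] with p hp
    have : p ≠ 1 := ne_of_lt hp
    simpa using this
  have := hs.comp hlim
  rw [show -(i : ℂ) / -(i * β) = β⁻¹ by field_simp] at this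
  refine this.congr' ?_
  filter_upwards [self_mem_nhdsWithin] with p hp
  have hp' : (p : ℂ) - 1 ≠ 0 := by
    rw [sub_ne_zero]
    exact_mod_cast (ne_of_lt hp : p ≠ 1)
  simp only [Function.comp_apply, Pi.div_apply, slope_def_field, one_pow, Complex.one_cpow,
    sub_self, sub_zero]
  rw [div_div_div_cancel_right₀ hp']

lemma tendsto_macdonaldFactor {β : ℂ} (hβ : β ≠ 0) {k : ℕ} (hk : 0 < k) {i : ℕ} (hi : i ≠ 0) :
    Tendsto (fun p : ℝ => (1 - (rootOfUnity k * p) ^ i) / (1 - (rootOfUnity k * (p : ℂ) ^ β) ^ i))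
      (𝓝[<] 1) (𝓝 (if k ∣ i then β⁻¹ else 1)) := by
  have hω := isPrimitiveRoot_rootOfUnity hk
  simp_rw [mul_pow]
  split_ifs with hd
  · simp_rw [(hω.pow_eq_one_iff_dvd i).mpr hd, one_mul]
    exact tendsto_div_of_dvd hβ hi
  · have h1 : 1 - rootOfUnity k ^ i ≠ 0 := by
      rw [sub_ne_zero]
      exact fun h => hd ((hω.pow_eq_one_iff_dvd i).mp h.symm)
    have ha := ((tendsto_ofReal_nhdsWithin.pow i).const_mul (rootOfUnity k ^ i)).const_sub 1
    have hb := (((tendsto_cpow_nhdsWithin β).pow i).const_mul (rootOfUnity k ^ i)).const_sub 1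
    rw [one_pow, mul_one] at ha hb
    have := ha.div hb h1
    rwa [div_self h1] at this

lemma tendsto_macdonaldWeight {β : ℂ} (hβ : β ≠ 0) {k : ℕ} (hk : 0 < k) (l : n.Partition) :
    Tendsto (fun p : ℝ => (zCoeff l : ℂ) * (l.parts.map fun i =>
      (1 - (rootOfUnity k * p) ^ i) / (1 - (rootOfUnity k * (p : ℂ) ^ β) ^ i)).prod)
      (𝓝[<] 1) (𝓝 (uglovWeight β k l)) := by
  have h : (β ^ (l.parts.countP fun i => k ∣ i))⁻¹ =
      (l.parts.map fun i => if k ∣ i then β⁻¹ else 1).prod := by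
    induction l.parts using Multiset.induction_on with
    | empty => simp
    | cons a s ih =>
      rw [Multiset.map_cons, Multiset.prod_cons, ← ih, Multiset.countP_cons]
      split_ifs <;> simp [pow_succ, mul_comm]
  rw [uglovWeight, h]
  exact Tendsto.const_mul _ (tendsto_multiset_prod _ fun i hi =>
    tendsto_macdonaldFactor hβ hk (l.parts_pos hi).ne')

lemma uglovWeight_ne_zero {β : ℂ} (hβ : β ≠ 0) (k : ℕ) (l : n.Partition) :
    uglovWeight β k l ≠ 0 := by
  refine mul_ne_zero ?_ (inv_ne_zero (pow_ne_zero _ hβ))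
  rw [Nat.cast_ne_zero, zCoeff, Finset.prod_ne_zero_iff]
  intro j hj
  exact mul_ne_zero (pow_ne_zero _ (l.parts_pos (Multiset.mem_toFinset.mp hj)).ne')
    (Nat.factorial_ne_zero _)

/-! ### Coordinates of the Uglov functions -/

lemma IsMacdonald.exists_eq_powerSumMap {q t : ℂ} {P : n.Partition → MvPowerSeries ℕ ℂ}
    (h : IsMacdonald q t n P) (l : n.Partition) : ∃ c, P l = powerSumMap n c := by
  obtain ⟨v, -, hP⟩ := h.triangular l
  have : P l ∈ LinearMap.range (powerSumMap n) := by
    rw [hP]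
    exact add_mem (monomialFn_mem_range l) (sum_mem fun m _ =>
      Submodule.smul_mem _ _ (monomialFn_mem_range m))
  obtain ⟨c, hc⟩ := this
  exact ⟨c, hc.symm⟩

lemma IsMacdonald.shapeCoeff_eq {q t : ℂ} {P : n.Partition → MvPowerSeries ℕ ℂ}
    (h : IsMacdonald q t n P) (l m : n.Partition) :
    (l = m → shapeCoeff n (P l) m = 1) ∧
      (l ≠ m → ¬ DominatedBy m l → shapeCoeff n (P l) m = 0) := by
  obtain ⟨v, hv, hP⟩ := h.triangular l
  have hc : shapeCoeff n (P l) m = (if m = l then 1 else 0) + v m := by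
    rw [hP, shapeCoeff_apply, map_add, coeff_shape_monomialFn, map_sum]
    simp [coeff_shape_monomialFn]
  have hv0 : ¬ DominatedBy m l → v m = 0 := fun hd => by
    by_contra h
    exact hd (hv m h)
  rw [hc]
  constructor
  · rintro rfl
    simp [hv0 fun hd => hd.1 rfl]
  · intro hne hd
    simp [hv0 hd, hne.symm]

lemma tendsto_shapeCoeff {ι : Type*} {F : Filter ι} {f : ι → MvPowerSeries ℕ ℂ}
    {g : MvPowerSeries ℕ ℂ} (h : Tendsto f F (𝓝 g)) (m : n.Partition) :
    Tendsto (fun i => shapeCoeff n (f i) m) F (𝓝 (shapeCoeff n g m)) :=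
  ((MvPowerSeries.WithPiTopology.continuous_coeff ℂ (shape m)).tendsto _).comp h

variable {β : ℂ} {k : ℕ} {U : ∀ n : ℕ, n.Partition → MvPowerSeries ℕ ℂ}

/-- The Uglov functions of degree `n` form a basis of the symmetric functions of degree `n`,
which is orthogonal for the limiting form. -/
lemma IsUglov.exists_matrix (hβ : β ≠ 0) (hk : 0 < k) (hU : IsUglov β k U) (n : ℕ) :
    ∃ u : Matrix n.Partition n.Partition ℂ, (∀ l, U n l = powerSumMap n (u l)) ∧ IsUnit u ∧
      ∀ l m, l ≠ m → ∑ j, uglovWeight β k j * u l j * u m j = 0 := by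
  obtain ⟨M, hM, hlim⟩ := hU n
  have hu : ∀ l, ∃ c, U n l = powerSumMap n c := fun l => by
    have : U n l ∈ Set.range (powerSumMap n) :=
      isClosedEmbedding_powerSumMap.isClosed_range.mem_of_tendsto (hlim l) (hM.mono fun p hp => by
        obtain ⟨c, hc⟩ := hp.exists_eq_powerSumMap l
        exact ⟨c, hc.symm⟩)
    obtain ⟨c, hc⟩ := this
    exact ⟨c, hc.symm⟩
  choose u hu using hu
  have hcoord : ∀ l, Tendsto (fun p => powerSumCoeff n (M p l)) (𝓝[<] 1) (𝓝 (u l)) := fun l => by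
    rw [isClosedEmbedding_powerSumMap.isEmbedding.tendsto_nhds_iff, ← hu]
    refine (hlim l).congr' (hM.mono fun p hp => ?_)
    obtain ⟨c, hc⟩ := hp.exists_eq_powerSumMap l
    rw [Function.comp_apply, hc, powerSumCoeff_powerSumMap]
  refine ⟨u, hu, ?_, fun l m hlm => ?_⟩
  -- The entries `0` and `1` prescribed by unitriangularity in the monomial basis persist in the
  -- limit. Independence of these rows implies that of the power sum coordinates `u`.
  · let T : Matrix n.Partition n.Partition ℂ := fun l => shapeCoeff n (U n l)
    have hT : IsUnit T := by
      refine isUnit_of_unitriangular (fun l => ?_) fun l m hlm hT => ?_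
      · refine tendsto_nhds_unique (tendsto_shapeCoeff (hlim l) l) (tendsto_const_nhds.congr'
          (hM.mono fun p hp => ((hp.shapeCoeff_eq l l).1 rfl).symm))
      · by_contra hd
        refine hT (tendsto_nhds_unique (tendsto_shapeCoeff (hlim l) m) (tendsto_const_nhds.congr'
          (hM.mono fun p hp => ((hp.shapeCoeff_eq l m).2 hlm hd).symm)))
    rw [← Matrix.linearIndependent_rows_iff_isUnit] at hT
    refine Matrix.linearIndependent_rows_iff_isUnit.mp ?_
    have he : T.row = (shapeCoeff n ∘ₗ powerSumMap n) ∘ u :=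
      funext fun l => congrArg (shapeCoeff n) (hu l)
    rw [he] at hT
    exact hT.of_comp
  · have h : Tendsto (fun p : ℝ => macdonaldForm (rootOfUnity k * p) (rootOfUnity k * (p : ℂ) ^ β) n
        (M p l) (M p m)) (𝓝[<] 1) (𝓝 (∑ j, uglovWeight β k j * u l j * u m j)) :=
      tendsto_finsetSum _ fun j _ => ((tendsto_macdonaldWeight hβ hk j).mul
        (tendsto_pi_nhds.mp (hcoord l) j)).mul (tendsto_pi_nhds.mp (hcoord m) j)
    exact tendsto_nhds_unique h (tendsto_const_nhds.congr'
      (hM.mono fun p hp => (hp.orthogonal l m hlm).symm))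

/-- Rows which are orthogonal for a nondegenerate diagonal form have nonzero norms, and the
dual relations hold. -/
lemma dual_orthogonality {ι : Type*} [Fintype ι] [DecidableEq ι] {u : Matrix ι ι ℂ} {w : ι → ℂ}
    (hw : ∀ i, w i ≠ 0) (hu : IsUnit u) (ho : ∀ l m, l ≠ m → ∑ j, w j * u l j * u m j = 0) :
    (∀ l, ∑ j, w j * u l j * u l j ≠ 0) ∧
      ∀ i j, ∑ l, (∑ j, w j * u l j * u l j)⁻¹ * (u l i * u l j) =
        if i = j then (w i)⁻¹ else 0 := by
  set G : ι → ℂ := fun l => ∑ j, w j * u l j * u l j with hG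
  have hmat : u * (Matrix.diagonal w * u.transpose) = Matrix.diagonal G := by
    ext l m
    rw [Matrix.mul_apply]
    simp only [Matrix.diagonal_mul, Matrix.transpose_apply, Matrix.diagonal_apply]
    split_ifs with h
    · subst h
      exact Finset.sum_congr rfl fun j _ => by ring
    · rw [← ho l m h]
      exact Finset.sum_congr rfl fun j _ => by ring
  -- The form is complex bilinear, so no positivity is available; nonvanishing of the norms comes
  -- from the determinant.
  have hdet : IsUnit (Matrix.diagonal G).det := by
    rw [← hmat, Matrix.det_mul, Matrix.det_mul, Matrix.det_transpose, Matrix.det_diagonal]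
    have hu' := (Matrix.isUnit_iff_isUnit_det u).mp hu
    exact hu'.mul ((isUnit_iff_ne_zero.mpr (Finset.prod_ne_zero_iff.mpr fun i _ => hw i)).mul hu')
  have hG0 : ∀ l, G l ≠ 0 := by
    rw [Matrix.det_diagonal, isUnit_iff_ne_zero, Finset.prod_ne_zero_iff] at hdet
    exact fun l => hdet l (Finset.mem_univ l)
  refine ⟨hG0, fun i j => ?_⟩
  have h1 : u * ((Matrix.diagonal w * u.transpose) * Matrix.diagonal fun l => (G l)⁻¹) = 1 := by
    rw [← mul_assoc, hmat, Matrix.diagonal_mul_diagonal]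
    simp [hG0]
  -- A one-sided inverse of a square matrix is two-sided: moving `u` to the other side turns row
  -- orthogonality into column orthogonality.
  have h2 : ((Matrix.diagonal w * u.transpose) * (Matrix.diagonal fun l => (G l)⁻¹) * u) i j =
      (1 : Matrix ι ι ℂ) i j := by rw [mul_eq_one_comm.mp h1]
  rw [Matrix.mul_apply] at h2
  simp only [Matrix.mul_diagonal, Matrix.diagonal_mul, Matrix.transpose_apply,
    Matrix.one_apply] at h2
  have h3 : w i * ∑ l, (G l)⁻¹ * (u l i * u l j) = if i = j then 1 else 0 := by
    rw [← h2, Finset.mul_sum]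
    exact Finset.sum_congr rfl fun l _ => by ring
  rw [← mul_right_inj' (hw i), h3]
  split_ifs <;> simp [hw i]

/-! ### Comparison of the two expansions in each degree -/

lemma uglovForm_powerSumMap (a b : n.Partition → ℂ) :
    uglovForm β k n (powerSumMap n a) (powerSumMap n b) =
      ∑ l, uglovWeight β k l * a l * b l :=
  diagonalForm_powerSumMap _ a b

lemma sum_cauchyTerm (hβ : β ≠ 0) (hk : 0 < k) (hU : IsUglov β k U) (n : ℕ) :
    ∑ l : n.Partition, cauchyTerm β k U ⟨n, l⟩ =
      ∑ l : n.Partition,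
        (uglovWeight β k l)⁻¹ • (inX (powerSumFn l) * inY (powerSumFn l)) := by
  obtain ⟨u, hu, hunit, ho⟩ := hU.exists_matrix hβ hk n
  obtain ⟨-, hdual⟩ := dual_orthogonality (uglovWeight_ne_zero hβ k) hunit ho
  have hterm : ∀ l : n.Partition, cauchyTerm β k U ⟨n, l⟩ =
      ∑ i, ∑ j, ((∑ j, uglovWeight β k j * u l j * u l j)⁻¹ * (u l i * u l j)) •
        (inX (powerSumFn i) * inY (powerSumFn j)) := fun l => by
    simp only [cauchyTerm]
    rw [hu, uglovForm_powerSumMap, one_div]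
    simp_rw [inX_eq, inY_eq, powerSumMap_apply, map_sum, map_smul, Finset.sum_mul_sum,
      Finset.smul_sum, smul_mul_smul_comm, smul_smul]
  simp_rw [hterm]
  rw [Finset.sum_comm]
  refine Finset.sum_congr rfl fun i _ => ?_
  rw [Finset.sum_comm]
  simp_rw [← Finset.sum_smul, hdual, ite_smul, zero_smul]
  simp

lemma le_order_powerSum (n : ℕ) : (n : ℕ∞) ≤ (powerSum n).order := by
  classical
  refine MvPowerSeries.le_order fun d hd => ?_
  rw [coeff_powerSum, if_neg]
  rintro ⟨i, rfl⟩
  simp at hd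

lemma le_order_powerSumMap (c : n.Partition → ℂ) : (n : ℕ∞) ≤ (powerSumMap n c).order := by
  refine MvPowerSeries.le_order fun d hd => ?_
  rw [powerSumMap_apply, map_sum]
  refine Finset.sum_eq_zero fun l _ => ?_
  have h := le_order_multiset_prod l.parts powerSum le_order_powerSum
  rw [l.parts_sum] at h
  rw [MvPowerSeries.coeff_smul, powerSumFn,
    coeff_eq_zero_of_le_order h (by exact_mod_cast hd), mul_zero]

lemma le_order_inX (f : MvPowerSeries ℕ ℂ) : f.order ≤ (inX f).order := by
  have h := MvPowerSeries.le_order_subst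
    (MvPowerSeries.HasSubst.X_comp (R := ℂ) (Function.Embedding.inl : ℕ ↪ ℕ ⊕ ℕ)) f
  refine le_trans (le_mul_of_one_le_left' (le_iInf fun i => ?_)) h
  exact MvPowerSeries.one_le_order_iff_constCoeff_eq_zero.mpr (by simp)

/-- In degree `n` the terms have order at least `n`, and there are finitely many partitions of each
`n`. -/
lemma summable_cauchyTerm (hβ : β ≠ 0) (hk : 0 < k) (hU : IsUglov β k U) :
    Summable (cauchyTerm β k U) := by
  rw [MvPowerSeries.WithPiTopology.summable_iff_summable_coeff]
  intro d
  refine summable_of_ne_finset_zero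
    (s := (Finset.range (d.degree + 1)).sigma fun _ => Finset.univ) ?_
  rintro ⟨n, l⟩ hl
  simp only [Finset.mem_sigma, Finset.mem_range, Finset.mem_univ, and_true, not_lt] at hl
  obtain ⟨u, hu, -⟩ := hU.exists_matrix hβ hk n
  refine coeff_eq_zero_of_le_order (n := n) ?_ hl
  refine le_trans ?_ MvPowerSeries.le_order_smul
  refine le_trans ?_ MvPowerSeries.le_order_mul
  refine le_trans (le_trans ?_ (le_order_inX _)) le_self_add
  change _ ≤ (U n l).order
  rw [hu]
  exact le_order_powerSumMap _

end

end Uglov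

theorem mainTheorem4 (k : ℕ) (hk : 0 < k) (β : ℂ) (hβ : β ≠ 0)
    (U : ∀ n : ℕ, n.Partition → MvPowerSeries ℕ ℂ) (hU : Uglov.IsUglov β k U) :
    (∀ (n : ℕ) (l : n.Partition), Uglov.uglovForm β k n (U n l) (U n l) ≠ 0) ∧
    Summable (Uglov.cauchyTerm β k U) ∧
    Multipliable (Uglov.cauchyFactor β k) ∧
    (∀ a ∈ Finset.Icc 1 (k - 1),
      Summable fun n : {n : ℕ // 0 < n ∧ n ≡ a [MOD k]} => Uglov.exponentTerm n n) ∧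
    Summable (fun n : ℕ+ => Uglov.exponentTerm n (n * k)) ∧
    ∑' l : (Σ n : ℕ, n.Partition), Uglov.cauchyTerm β k U l =
      ∏' ij : ℕ × ℕ, Uglov.cauchyFactor β k ij ∧
    ∏' ij : ℕ × ℕ, Uglov.cauchyFactor β k ij =
      Uglov.expSeries
        ((∑ a ∈ Finset.Icc 1 (k - 1),
            ∑' n : {n : ℕ // 0 < n ∧ n ≡ a [MOD k]}, Uglov.exponentTerm n n) +
          (β / k) • ∑' n : ℕ+, Uglov.exponentTerm n (n * k)) := by
  have hprod := Uglov.hasProd_cauchyFactor β hk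
  have hsum := Uglov.summable_cauchyTerm hβ hk hU
  have hpart := Uglov.hasSum_partition (Uglov.hasSum_exponent β hk)
  refine ⟨fun n l => ?_, hsum, hprod.multipliable,
    fun a _ => Uglov.summable_exponentTerm.subtype {n : ℕ | 0 < n ∧ n ≡ a [MOD k]},
    Uglov.summable_exponentTerm_mul hk, ?_, hprod.tprod_eq⟩
  · obtain ⟨u, hu, hunit, ho⟩ := hU.exists_matrix hβ hk n
    rw [hu, Uglov.uglovForm_powerSumMap]
    exact (Uglov.dual_orthogonality (Uglov.uglovWeight_ne_zero hβ k) hunit ho).1 l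
  · rw [hprod.tprod_eq]
    -- Both sums over partitions are grouped by degree. The degree `n` parts agree by
    -- `sum_cauchyTerm`, so the totals agree.
    have h1 := hsum.hasSum.sigma fun n => hasSum_fintype _
    have h2 := hpart.sigma fun n => hasSum_fintype _
    simp_rw [Uglov.sum_cauchyTerm hβ hk hU] at h1
    exact h1.unique h2
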